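/- Let $\mathbb K$ be a field of characteristic $0$ and let $\mathfrak g$ be a Lie superalgebra over $\mathbb K$ (of arbitrary dimension). Let $\mathfrak g=\mathfrak g_-\oplus\mathfrak h$ be a decomposition into a direct sum of sub-superspaces (in particular $\mathfrak h$ may be any Lie subsuperalgebra and $\mathfrak g_-$ any complementary sub-superspace, not necessarily a subalgebra), with projections $\Pi_{\mathfrak g_-}$, $\Pi_{\mathfrak h}$. Let $(P_i)_{i\in I}$ be a homogeneous basis of $\mathfrak g_-$, let $(X^i)_{i\in I}$ be the dual topological basis of $\mathfrak g_-^*$, so that $|X^i|=|P_i|$ and $S(\mathfrak g_-)^*=\mathbb K[[X]]$ (supercommutative formal power series), and put $A=\mathbb K[\varepsilon_{0},\varepsilon_{1}]/(\varepsilon_{0}^2)\otimes S(\mathfrak g_-)^*$, where $\varepsilon_0$ is an even and $\varepsilon_1$ an odd supercommuting indeterminate. For a discrete superspace $W$, $A\hat\otimes W$ is the completed tensor product, i.e. the space of formal series $\sum_m m\otimes w_m$ over the monomials $m$ in $\varepsilon_0,\varepsilon_1,X$ with arbitrary $w_m\in W$; $S(\mathfrak g_-)^*\hat\otimes W$ is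 the subspace of the series without $\varepsilon_0,\varepsilon_1$. Thus $A\hat\otimes\mathfrak g$ is a Lie superalgebra and $A\hat\otimes U(\mathfrak g)$ an associative superalgebra. Let $XP=\sum_i X^i\otimes P_i\in A\hat\otimes\mathfrak g$, and write $\Pi_{\mathfrak g_-},\Pi_{\mathfrak h}$ also for $1\otimes\Pi_{\mathfrak g_-}$, $1\otimes\Pi_{\mathfrak h}$. For a formal power series $f(t)=\sum f_nt^n$ let $f(\operatorname{ad}XP)=\sum_n f_n(\operatorname{ad}XP)^n$, acting on $A\hat\otimes\mathfrak g$. Then the operators $$T_-=\left.\Pi_{\mathfrak g_-}\frac{e^{-\operatorname{ad}XP}-1}{\operatorname{ad}XP}\right|_{A\hat\otimes\mathfrak g_-},\qquad T_{\mathfrak h}=\left.\Pi_{\mathfrak h}\frac{\operatorname{ad}XP}{e^{-\operatorname{ad}XP}-1}\right|_{A\hat\otimes\mathfrak h}$$ on $A\hat\otimes\mathfrak g_-$ and on $A\hat\otimes\mathfrak h$ are invertible, and the formulas $$\mathcal A(g)=\sum_i\varphi^i(X,g)P_i=-T_-^{-1}\,\Pi_{\mathfrak g_-}e^{-\operatorname{ad}XP}g,\qquad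 \mathcal B(g)=h(X,g)=T_{\mathfrak h}^{-1}\,\Pi_{\mathfrak h}\frac{\operatorname{ad}XP}{e^{-\operatorname{ad}XP}-1}e^{-\operatorname{ad}XP}g$$ define even linear maps $\mathcal A:\mathfrak g\to S(\mathfrak g_-)^*\hat\otimes\mathfrak g_-$ and $\mathcal B:\mathfrak g\to S(\mathfrak g_-)^*\hat\otimes\mathfrak h$. Moreover, for every homogeneous $g\in\mathfrak g$, with $\varepsilon=\varepsilon_{|g|}$, one has $\sum_i(X^i+\varepsilon\varphi^i(X,g))P_i=XP+\varepsilon\mathcal A(g)$, and in $A\hat\otimes U(\mathfrak g)$ $$e^{\varepsilon g}e^{XP}=e^{(X+\varepsilon\varphi(X,g))P}\,e^{\varepsilon h(X,g)},$$ i.e. $e^{\varepsilon g}e^{XP}=e^{XP+\varepsilon\mathcal A(g)}e^{\varepsilon\mathcal B(g)}$. In particular, even linear maps $\mathcal A,\mathcal B$ with this property always exist. -/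

import Mathlib

namespace SuperSeries

set_option linter.unusedSectionVars false

open Finset.HasAntidiagonal (antidiagonal mem_antidiagonal)

/-! ### Superspaces, superalgebras, Lie superalgebras -/

/-- A superstructure on a vector space, given by its parity operator. -/
class Superspace (K W : Type*) [Field K] [AddCommGroup W] [Module K W] where
  parity : W →ₗ[K] W
  parity_parity : ∀ x, parity (parity x) = x

/-- The parity operator. -/
def par (K : Type*) {W : Type*} [Field K] [AddCommGroup W] [Module K W] [Superspace K W] :
    W →ₗ[K] W := Superspace.parity

/-- `x` is homogeneous of parity `i` (`0` is even, `1` is odd). -/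
def IsHomog (K : Type*) {W : Type*} [Field K] [AddCommGroup W] [Module K W] [Superspace K W]
    (i : Fin 2) (x : W) : Prop :=
  par K x = (-1 : K) ^ (i : ℕ) • x

/-- An associative unital superalgebra. -/
class Superalgebra (K B : Type*) [Field K] [Ring B] [Algebra K B] extends Superspace K B where
  parity_one : parity 1 = 1
  parity_mul : ∀ x y, parity (x * y) = parity x * parity y

/-- The ground field, purely even. -/
instance instSuperalgebraField (K : Type*) [Field K] : Superalgebra K K where
  parity := LinearMap.id
  parity_parity _ := rfl
  parity_one := rfl
  parity_mul _ _ := rfl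

/-- A Lie superalgebra over `K` (of characteristic different from `2` and `3`): the bracket is
even, super-antisymmetric and satisfies the super Jacobi identity. -/
class LieSuperalgebra (K 𝔤 : Type*) [Field K] [AddCommGroup 𝔤] [Module K 𝔤]
    extends Superspace K 𝔤 where
  bracket : 𝔤 →ₗ[K] 𝔤 →ₗ[K] 𝔤
  parity_bracket : ∀ x y, parity (bracket x y) = bracket (parity x) (parity y)
  skew : ∀ (i j : Fin 2) (x y : 𝔤), IsHomog K i x → IsHomog K j y →
    bracket x y = -((-1 : K) ^ ((i : ℕ) * (j : ℕ)) • bracket y x)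
  jacobi : ∀ (i j : Fin 2) (x y z : 𝔤), IsHomog K i x → IsHomog K j y →
    bracket x (bracket y z) =
      bracket (bracket x y) z + (-1 : K) ^ ((i : ℕ) * (j : ℕ)) • bracket y (bracket x z)

/-! ### The universal enveloping superalgebra -/

section Enveloping

variable (K 𝔤 : Type*) [Field K] [AddCommGroup 𝔤] [Module K 𝔤] [LieSuperalgebra K 𝔤]

/-- The relations `x y = (-1)^{|x||y|} y x + [x, y]` for homogeneous `x`, `y`. -/
inductive EnvRel : TensorAlgebra K 𝔤 → TensorAlgebra K 𝔤 → Prop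
  | comm (i j : Fin 2) (x y : 𝔤) (hx : IsHomog K i x) (hy : IsHomog K j y) :
      EnvRel (TensorAlgebra.ι K x * TensorAlgebra.ι K y)
        ((-1 : K) ^ ((i : ℕ) * (j : ℕ)) • (TensorAlgebra.ι K y * TensorAlgebra.ι K x) +
          TensorAlgebra.ι K (LieSuperalgebra.bracket (K := K) x y))

/-- The universal enveloping superalgebra `U(𝔤)`. -/
def Env : Type _ := RingQuot (EnvRel K 𝔤)

instance instRingEnv : Ring (Env K 𝔤) := inferInstanceAs (Ring (RingQuot (EnvRel K 𝔤)))

instance instAlgebraEnv : Algebra K (Env K 𝔤) :=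
  inferInstanceAs (Algebra K (RingQuot (EnvRel K 𝔤)))

/-- The quotient map from the tensor algebra. -/
noncomputable def Env.mk : TensorAlgebra K 𝔤 →ₐ[K] Env K 𝔤 := RingQuot.mkAlgHom K (EnvRel K 𝔤)

/-- The canonical map `𝔤 → U(𝔤)`. -/
noncomputable def Env.ι : 𝔤 →ₗ[K] Env K 𝔤 := (Env.mk K 𝔤).toLinearMap ∘ₗ TensorAlgebra.ι K

theorem Env.ι_mul_ι (i j : Fin 2) (x y : 𝔤) (hx : IsHomog K i x) (hy : IsHomog K j y) :
    Env.ι K 𝔤 x * Env.ι K 𝔤 y =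
      (-1 : K) ^ ((i : ℕ) * (j : ℕ)) • (Env.ι K 𝔤 y * Env.ι K 𝔤 x) +
        Env.ι K 𝔤 (LieSuperalgebra.bracket (K := K) x y) := by
  have h := RingQuot.mkAlgHom_rel K (EnvRel.comm (K := K) i j x y hx hy)
  rw [map_mul, map_add, map_smul, map_mul] at h
  exact h

theorem Env.parity_aux ⦃a b : TensorAlgebra K 𝔤⦄ (h : EnvRel K 𝔤 a b) :
    TensorAlgebra.lift K (Env.ι K 𝔤 ∘ₗ par K) a =
      TensorAlgebra.lift K (Env.ι K 𝔤 ∘ₗ par K) b := by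
  obtain ⟨i, j, x, y, hx, hy⟩ := h
  have hx' : IsHomog K i (par K x) := by
    unfold IsHomog at *
    rw [hx, map_smul, hx]
  have hy' : IsHomog K j (par K y) := by
    unfold IsHomog at *
    rw [hy, map_smul, hy]
  have := Env.ι_mul_ι K 𝔤 i j _ _ hx' hy'
  have hb : LieSuperalgebra.bracket (K := K) (par K x) (par K y) =
      par K (LieSuperalgebra.bracket (K := K) x y) := (LieSuperalgebra.parity_bracket x y).symm
  rw [hb] at this
  simpa using this

/-- The parity operator of `U(𝔤)`: the algebra morphism extending that of `𝔤`. -/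
noncomputable def Env.parityHom : Env K 𝔤 →ₐ[K] Env K 𝔤 :=
  RingQuot.liftAlgHom K ⟨TensorAlgebra.lift K (Env.ι K 𝔤 ∘ₗ par K),
    Env.parity_aux K 𝔤⟩

theorem Env.parityHom_ι (x : 𝔤) :
    Env.parityHom K 𝔤 (Env.ι K 𝔤 x) = Env.ι K 𝔤 (par K x) := by
  have := RingQuot.liftAlgHom_mkAlgHom_apply K
    (TensorAlgebra.lift K (Env.ι K 𝔤 ∘ₗ par K)) (Env.parity_aux K 𝔤)
    (TensorAlgebra.ι K x)
  rw [TensorAlgebra.lift_ι_apply] at this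
  exact this

theorem Env.parityHom_parityHom (u : Env K 𝔤) :
    Env.parityHom K 𝔤 (Env.parityHom K 𝔤 u) = u := by
  have : (Env.parityHom K 𝔤).comp (Env.parityHom K 𝔤) = AlgHom.id K _ := by
    refine RingQuot.ringQuot_ext' K _ _ ?_
    refine TensorAlgebra.hom_ext ?_
    ext x
    have : Env.parityHom K 𝔤 (Env.parityHom K 𝔤 (Env.ι K 𝔤 x)) = Env.ι K 𝔤 x := by
      rw [Env.parityHom_ι, Env.parityHom_ι]
      exact congrArg _ (Superspace.parity_parity x)
    exact this
  exact DFunLike.congr_fun this u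

noncomputable instance instSuperalgebraEnv : Superalgebra K (Env K 𝔤) where
  parity := (Env.parityHom K 𝔤).toLinearMap
  parity_parity := Env.parityHom_parityHom K 𝔤
  parity_one := map_one (Env.parityHom K 𝔤)
  parity_mul := map_mul (Env.parityHom K 𝔤)

end Enveloping

/-! ### Formal series in the supercommuting variables `ε₀, ε₁, Xⁱ`

`ε₀`, `ε₁` are even and odd respectively, `Xⁱ` has parity `d i`, and `ε₀² = 0`. -/

/-- The variables, `ε₀, ε₁` coming before all `Xⁱ`. -/
abbrev Var (I : Type*) : Type _ := Fin 2 ⊕ₗ I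

/-- The variable `ε₀` or `ε₁`. -/
def Var.eps {I : Type*} (k : Fin 2) : Var I := toLex (Sum.inl k)

/-- The variable `Xⁱ`. -/
def Var.X {I : Type*} (i : I) : Var I := toLex (Sum.inr i)

/-- The parity of a variable. -/
def vpar {I : Type*} (d : I → Fin 2) (v : Var I) : Fin 2 := Sum.elim id d (ofLex v)

/-- A monomial is admissible if the odd variables and `ε₀` occur at most once in it. -/
def Adm {I : Type*} (d : I → Fin 2) (m : Var I →₀ ℕ) : Prop :=
  ∀ v, (v = Var.eps 0 ∨ vpar d v = 1) → m v ≤ 1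

/-- Admissible monomials: the ordered monomials in `ε₀, ε₁, Xⁱ`, a topological basis of
`A = K[ε₀, ε₁]/(ε₀²) ⊗ S(𝔤₋)^*`. -/
def Mon {I : Type*} (d : I → Fin 2) : Type _ := {m : Var I →₀ ℕ // Adm d m}

/-- The number of odd variables in a monomial, with multiplicity. -/
def oddDeg {I : Type*} (d : I → Fin 2) (m : Var I →₀ ℕ) : ℕ :=
  m.sum fun v n => (vpar d v : ℕ) * n

/-- The number of transpositions of odd variables needed to sort the product of the ordered
monomials `a` and `b`. -/
def inversions {I : Type*} [LinearOrder I] (d : I → Fin 2) (a b : Var I →₀ ℕ) : ℕ :=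
  a.sum fun v n => b.sum fun w k =>
    if w < v then (vpar d v : ℕ) * n * ((vpar d w : ℕ) * k) else 0

/-- The completed tensor product `A ⊗̂ W` with a discrete superspace `W`: formal series
`∑ₘ m ⊗ wₘ` over all monomials `m`, with arbitrary coefficients `wₘ ∈ W`. -/
def Series (_K : Type*) {I : Type*} (d : I → Fin 2) (W : Type*) : Type _ :=
  Mon d → W

namespace Series

section Basic

variable {K I : Type*} [Field K] {d : I → Fin 2} {W W' : Type*}
  [AddCommGroup W] [Module K W] [AddCommGroup W'] [Module K W']

instance : AddCommGroup (Series K d W) := inferInstanceAs (AddCommGroup (Mon d → W))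

instance : Module K (Series K d W) := inferInstanceAs (Module K (Mon d → W))

open Classical in
/-- The coefficient of a series at any monomial (zero at the non-admissible ones). -/
noncomputable def coeff (F : Series K d W) (m : Var I →₀ ℕ) : W :=
  if h : Adm d m then F ⟨m, h⟩ else 0

open Classical in
/-- The series `v^m ⊗ w` with a single term (it is zero if `v^m = 0` in `A`). -/
noncomputable def monomial (m : Var I →₀ ℕ) (w : W) : Series K d W :=
  fun m' => if m'.1 = m then w else 0

/-- The map `∑ₘ m ⊗ wₘ ↦ ∑ₘ m ⊗ f(wₘ)` (this is `1 ⊗ f` when `f` is even). -/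
def map (f : W →ₗ[K] W') : Series K d W →ₗ[K] Series K d W' where
  toFun F := fun m => f (F m)
  map_add' F G := funext fun m => map_add f (F m) (G m)
  map_smul' c F := funext fun m => map_smul f c (F m)

/-- The sum of an infinite series of elements `A ⊗̂ W` that converges coefficientwise. -/
noncomputable def tsum {α : Type*} (F : α → Series K d W) : Series K d W :=
  fun m => ∑ᶠ a, F a m

/-- Coefficientwise convergence of an infinite series, i.e. summability in the topology of
`A ⊗̂ W` (the product topology, the coefficients being discrete). -/
def Summable {α : Type*} (F : α → Series K d W) : Prop :=
  ∀ m, {a | F a m ≠ 0}.Finite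

/-- The series does not contain `ε₀, ε₁`, i.e. it lies in `S(𝔤₋)^* ⊗̂ W ⊆ A ⊗̂ W`. -/
def EpsFree (F : Series K d W) : Prop :=
  ∀ m : Mon d, (∃ k, m.1 (Var.eps k) ≠ 0) → F m = 0

/-- The parity operator of `A ⊗̂ W`. -/
noncomputable def parity [Superspace K W] (F : Series K d W) : Series K d W :=
  fun m => (-1 : K) ^ oddDeg d m.1 • par K (F m)

end Basic

section Mul

variable {K I : Type*} [Field K] [LinearOrder I] {d : I → Fin 2} {W₁ W₂ W₃ : Type*}
  [AddCommGroup W₁] [Module K W₁] [AddCommGroup W₂] [Module K W₂] [AddCommGroup W₃] [Module K W₃]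

/-- The `A`-bilinear extension of a bilinear even map `β`, by the sign rule
`(a ⊗ x) (b ⊗ y) = (-1)^{|x||b|} a b ⊗ β(x, y)`. -/
noncomputable def conv [Superspace K W₁] (β : W₁ →ₗ[K] W₂ →ₗ[K] W₃)
    (F : Series K d W₁) (G : Series K d W₂) : Series K d W₃ :=
  fun c => ∑ p ∈ antidiagonal c.1, (-1 : K) ^ inversions d p.1 p.2 •
    β ((par K)^[oddDeg d p.2] (F.coeff p.1)) (G.coeff p.2)

theorem adm_of_le {a c : Var I →₀ ℕ} (h : a ≤ c) (hc : Adm d c) : Adm d a :=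
  fun v hv => (h v).trans (hc v hv)

theorem coeff_of_adm {W : Type*} [AddCommGroup W] [Module K W] (F : Series K d W)
    {m : Var I →₀ ℕ} (h : Adm d m) : F.coeff m = F ⟨m, h⟩ := dif_pos h

theorem coeff_add {W : Type*} [AddCommGroup W] [Module K W] (F G : Series K d W)
    (m : Var I →₀ ℕ) : (F + G).coeff m = F.coeff m + G.coeff m := by
  unfold coeff
  split_ifs
  · rfl
  · simp

theorem coeff_zero {W : Type*} [AddCommGroup W] [Module K W]
    (m : Var I →₀ ℕ) : (0 : Series K d W).coeff m = 0 := by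
  unfold coeff
  split_ifs
  · rfl
  · rfl

theorem adm_zero : Adm d (0 : Var I →₀ ℕ) := fun _ _ => by simp

theorem coeff_monomial_zero {W : Type*} [AddCommGroup W] [Module K W] (w : W)
    (m : Var I →₀ ℕ) : (monomial 0 w : Series K d W).coeff m = if m = 0 then w else 0 := by
  unfold coeff monomial
  split_ifs with h1 h2 h2 <;> try rfl
  subst h2
  exact absurd adm_zero h1

theorem inversions_add_left (a b c : Var I →₀ ℕ) :
    inversions d (a + b) c = inversions d a c + inversions d b c := by
  unfold inversions
  refine Finsupp.sum_add_index' (fun v => ?_) (fun v n n' => ?_)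
  · simp [Finsupp.sum]
  · rw [← Finsupp.sum_add]
    refine Finsupp.sum_congr fun w _ => ?_
    split_ifs <;> ring

theorem inversions_add_right (a b c : Var I →₀ ℕ) :
    inversions d a (b + c) = inversions d a b + inversions d a c := by
  unfold inversions
  rw [← Finsupp.sum_add]
  refine Finsupp.sum_congr fun v _ => ?_
  refine Finsupp.sum_add_index' (fun w => ?_) (fun w n n' => ?_)
  · simp
  · split_ifs <;> ring

theorem inversions_zero_left (a : Var I →₀ ℕ) : inversions d 0 a = 0 := by
  simp [inversions]

theorem inversions_zero_right (a : Var I →₀ ℕ) : inversions d a 0 = 0 := by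
  simp [inversions, Finsupp.sum]

theorem oddDeg_add (a b : Var I →₀ ℕ) : oddDeg d (a + b) = oddDeg d a + oddDeg d b :=
  Finsupp.sum_add_index' (fun v => by simp) (fun v n n' => by ring)

theorem oddDeg_zero : oddDeg d (0 : Var I →₀ ℕ) = 0 := by simp [oddDeg]

end Mul

section Ring

variable {K I : Type*} [Field K] [LinearOrder I] {d : I → Fin 2} {B : Type*}
  [Ring B] [Algebra K B] [Superalgebra K B]

noncomputable instance : Mul (Series K d B) := ⟨conv (LinearMap.mul K B)⟩

noncomputable instance : One (Series K d B) := ⟨monomial 0 1⟩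

theorem coeff_one (m : Var I →₀ ℕ) : (1 : Series K d B).coeff m = if m = 0 then 1 else 0 :=
  coeff_monomial_zero 1 m

theorem coeff_mul (F G : Series K d B) {c : Var I →₀ ℕ} (hc : Adm d c) :
    (F * G).coeff c = ∑ p ∈ antidiagonal c, (-1 : K) ^ inversions d p.1 p.2 •
      ((par K)^[oddDeg d p.2] (F.coeff p.1) * G.coeff p.2) :=
  coeff_of_adm _ hc

theorem ext_coeff {F G : Series K d B} (h : ∀ m, Adm d m → F.coeff m = G.coeff m) : F = G := by
  funext m
  have := h m.1 m.2
  rwa [coeff_of_adm F m.2, coeff_of_adm G m.2] at this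

theorem iterate_par_one (n : ℕ) : (par K)^[n] (1 : B) = 1 :=
  Function.iterate_fixed Superalgebra.parity_one n

theorem iterate_par_mul (n : ℕ) (x y : B) :
    (par K)^[n] (x * y) = (par K)^[n] x * (par K)^[n] y := by
  induction n generalizing x y with
  | zero => rfl
  | succ n ih =>
    simp only [Function.iterate_succ, Function.comp]
    rw [← ih]
    exact congrArg _ (Superalgebra.parity_mul x y)

theorem iterate_par_eq_pow (n : ℕ) (x : B) : (par K)^[n] x = (par K ^ n) x := by
  rw [Module.End.pow_apply]

theorem mul_assoc_aux (F G H : Series K d B) : F * G * H = F * (G * H) := by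
  refine ext_coeff fun c hc => ?_
  have hle : ∀ {p : (Var I →₀ ℕ) × (Var I →₀ ℕ)}, p ∈ antidiagonal c → Adm d p.1 ∧ Adm d p.2 := by
    intro p hp
    rw [mem_antidiagonal] at hp
    exact ⟨adm_of_le (hp ▸ le_self_add) hc, adm_of_le (hp ▸ le_add_self) hc⟩
  rw [coeff_mul _ _ hc, coeff_mul _ _ hc]
  have e1 : ∀ p ∈ antidiagonal c, (-1 : K) ^ inversions d p.1 p.2 •
      ((par K)^[oddDeg d p.2] ((F * G).coeff p.1) * H.coeff p.2) =
      ∑ q ∈ antidiagonal p.1, (-1 : K) ^ (inversions d p.1 p.2 + inversions d q.1 q.2) •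
        ((par K)^[oddDeg d p.2 + oddDeg d q.2] (F.coeff q.1) *
          ((par K)^[oddDeg d p.2] (G.coeff q.2) * H.coeff p.2)) := by
    intro p hp
    rw [coeff_mul _ _ (hle hp).1, iterate_par_eq_pow, map_sum, Finset.sum_mul, Finset.smul_sum]
    refine Finset.sum_congr rfl fun q _ => ?_
    rw [map_smul, ← iterate_par_eq_pow, iterate_par_mul, smul_mul_assoc, smul_smul, ← pow_add,
      ← Function.iterate_add_apply, mul_assoc]
  have e2 : ∀ p ∈ antidiagonal c, (-1 : K) ^ inversions d p.1 p.2 •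
      ((par K)^[oddDeg d p.2] (F.coeff p.1) * (G * H).coeff p.2) =
      ∑ q ∈ antidiagonal p.2, (-1 : K) ^ (inversions d p.1 p.2 + inversions d q.1 q.2) •
        ((par K)^[oddDeg d p.2] (F.coeff p.1) *
          ((par K)^[oddDeg d q.2] (G.coeff q.1) * H.coeff q.2)) := by
    intro p hp
    rw [coeff_mul _ _ (hle hp).2, Finset.mul_sum, Finset.smul_sum]
    refine Finset.sum_congr rfl fun q _ => ?_
    rw [mul_smul_comm, smul_smul, ← pow_add]
  rw [Finset.sum_congr rfl e1, Finset.sum_congr rfl e2, Finset.sum_sigma', Finset.sum_sigma']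
  refine Finset.sum_nbij' (fun x => ⟨(x.2.1, x.2.2 + x.1.2), (x.2.2, x.1.2)⟩)
    (fun x => ⟨(x.1.1 + x.2.1, x.2.2), (x.1.1, x.2.1)⟩) ?_ ?_ ?_ ?_ ?_
  · rintro ⟨⟨u, w⟩, ⟨a, b⟩⟩ h
    simp only [Finset.mem_sigma, mem_antidiagonal] at h ⊢
    obtain ⟨h1, h2⟩ := h
    subst h2
    exact ⟨by rw [← h1, add_assoc], trivial⟩
  · rintro ⟨⟨a, v⟩, ⟨b, w⟩⟩ h
    simp only [Finset.mem_sigma, mem_antidiagonal] at h ⊢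
    obtain ⟨h1, h2⟩ := h
    subst h2
    exact ⟨by rw [← h1, add_assoc], trivial⟩
  · rintro ⟨⟨u, w⟩, ⟨a, b⟩⟩ h
    simp only [Finset.mem_sigma, mem_antidiagonal] at h
    obtain ⟨h1, h2⟩ := h
    subst h2
    rfl
  · rintro ⟨⟨a, v⟩, ⟨b, w⟩⟩ h
    simp only [Finset.mem_sigma, mem_antidiagonal] at h
    obtain ⟨h1, h2⟩ := h
    subst h2
    rfl
  · rintro ⟨⟨u, w⟩, ⟨a, b⟩⟩ h
    simp only [Finset.mem_sigma, mem_antidiagonal] at h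
    obtain ⟨h1, h2⟩ := h
    subst h2
    simp only [inversions_add_left, inversions_add_right, oddDeg_add]
    rw [Nat.add_comm (oddDeg d w) (oddDeg d b)]
    congr 2
    ring

/-- The superalgebra `A ⊗̂ B`, for a discrete associative superalgebra `B`. -/
noncomputable instance : Ring (Series K d B) where
  __ := (inferInstance : AddCommGroup (Series K d B))
  mul_assoc := mul_assoc_aux
  one_mul F := by
    refine ext_coeff fun c hc => ?_
    rw [coeff_mul _ _ hc, Finset.sum_eq_single (0, c)]
    · simp [coeff_one, inversions_zero_left, iterate_par_one]
    · rintro ⟨a, b⟩ h hne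
      have ha : a ≠ 0 := by
        rintro rfl
        rw [mem_antidiagonal, zero_add] at h
        exact hne (by rw [← h])
      simp [coeff_one, ha]
    · simp
  mul_one F := by
    refine ext_coeff fun c hc => ?_
    rw [coeff_mul _ _ hc, Finset.sum_eq_single (c, 0)]
    · simp [coeff_one, inversions_zero_right, oddDeg_zero]
    · rintro ⟨a, b⟩ h hne
      have hb : b ≠ 0 := by
        rintro rfl
        rw [mem_antidiagonal, add_zero] at h
        exact hne (by rw [← h])
      simp [coeff_one, hb]
    · simp
  zero_mul F := by
    refine ext_coeff fun c hc => ?_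
    rw [coeff_mul _ _ hc]
    simp [coeff_zero]
  mul_zero F := by
    refine ext_coeff fun c hc => ?_
    rw [coeff_mul _ _ hc]
    simp [coeff_zero]
  left_distrib F G H := by
    refine ext_coeff fun c hc => ?_
    rw [coeff_add, coeff_mul _ _ hc, coeff_mul _ _ hc, coeff_mul _ _ hc, ← Finset.sum_add_distrib]
    refine Finset.sum_congr rfl fun p _ => ?_
    rw [coeff_add, mul_add, smul_add]
  right_distrib F G H := by
    refine ext_coeff fun c hc => ?_
    rw [coeff_add, coeff_mul _ _ hc, coeff_mul _ _ hc, coeff_mul _ _ hc, ← Finset.sum_add_distrib]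
    refine Finset.sum_congr rfl fun p _ => ?_
    rw [coeff_add, iterate_par_eq_pow, map_add, ← iterate_par_eq_pow, ← iterate_par_eq_pow,
      add_mul, smul_add]

theorem coeff_pow_eq_zero {F : Series K d B} (h : F.coeff 0 = 0) :
    ∀ (n : ℕ) (c : Var I →₀ ℕ), c.degree < n → (F ^ n).coeff c = 0 := by
  intro n
  induction n with
  | zero => intro c hc; omega
  | succ n ih =>
    intro c hc
    by_cases hA : Adm d c
    · rw [pow_succ, coeff_mul _ _ hA]
      refine Finset.sum_eq_zero fun p hp => ?_
      rw [mem_antidiagonal] at hp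
      by_cases hq : p.2 = 0
      · rw [hq, h, mul_zero, smul_zero]
      · have h1 : p.1.degree + p.2.degree = c.degree := by rw [← hp, map_add]
        have h2 : p.2.degree ≠ 0 := by rwa [Ne, Finsupp.degree_eq_zero_iff]
        rw [ih p.1 (by omega), iterate_par_eq_pow, map_zero, zero_mul, smul_zero]
    · exact dif_neg hA

/-- The exponential series of `F` converges if `F` has no constant term. -/
theorem summable_exp {F : Series K d B} (h : F.coeff 0 = 0) :
    Summable fun n : ℕ => ((n.factorial : K)⁻¹ • F ^ n : Series K d B) := by
  intro m
  refine (Set.finite_Iic m.1.degree).subset fun n hn => ?_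
  by_contra hlt
  apply hn
  have := coeff_pow_eq_zero h n m.1 (by simpa using hlt)
  rw [coeff_of_adm _ m.2] at this
  exact (congrArg ((n.factorial : K)⁻¹ • ·) this).trans (smul_zero _)

/-- The exponential `∑ₙ Fⁿ / n!` in `A ⊗̂ B`. -/
noncomputable def exp (F : Series K d B) : Series K d B :=
  tsum fun n : ℕ => ((n.factorial : K)⁻¹ • F ^ n : Series K d B)

end Ring

section Operators

variable {K I : Type*} [Field K] [LinearOrder I] {d : I → Fin 2} {𝔤 : Type*}
  [AddCommGroup 𝔤] [Module K 𝔤]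

/-- The (coefficientwise convergent) sum `∑ᵢ cᵢ ⊗ Pᵢ`, for `cᵢ ∈ A`. -/
noncomputable def pairing (c : I → Series K d K) (P : I → 𝔤) : Series K d 𝔤 :=
  tsum fun i => ((fun m => (c i m : K) • P i) : Series K d 𝔤)

/-- The variable `Xⁱ ∈ A`. -/
noncomputable def X (i : I) : Series K d K := monomial (Finsupp.single (Var.X i) 1) 1

/-- The variable `ε₀` or `ε₁` of `A`. -/
noncomputable def eps (k : Fin 2) : Series K d K := monomial (Finsupp.single (Var.eps k) 1) 1

/-- The element `1 ⊗ w` of `A ⊗̂ W`. -/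
noncomputable def const (w : 𝔤) : Series K d 𝔤 := monomial 0 w

/-- The left action of `A` on `A ⊗̂ W`: `a (b ⊗ w) = a b ⊗ w`. -/
noncomputable def lsmul (a : Series K d K) (F : Series K d 𝔤) : Series K d 𝔤 :=
  conv (LinearMap.lsmul K 𝔤) a F

/-- The operator `ad F` on the Lie superalgebra `A ⊗̂ 𝔤`. -/
noncomputable def ad [LieSuperalgebra K 𝔤] (F G : Series K d 𝔤) : Series K d 𝔤 :=
  conv LieSuperalgebra.bracket F G

/-- `f(T) F = ∑ₙ fₙ Tⁿ F` for a formal power series `f = ∑ₙ fₙ tⁿ` and an operator `T` on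
`A ⊗̂ 𝔤`. -/
noncomputable def opSeries (f : PowerSeries K) (T : Series K d 𝔤 → Series K d 𝔤)
    (F : Series K d 𝔤) : Series K d 𝔤 :=
  tsum fun n : ℕ => (PowerSeries.coeff n f • T^[n] F : Series K d 𝔤)

theorem coeff_ad_iterate_eq_zero [LieSuperalgebra K 𝔤] {F : Series K d 𝔤} (h : F.coeff 0 = 0)
    (G : Series K d 𝔤) :
    ∀ (n : ℕ) (c : Var I →₀ ℕ), c.degree < n → ((ad F)^[n] G).coeff c = 0 := by
  intro n
  induction n with
  | zero => intro c hc; omega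
  | succ n ih =>
    intro c hc
    rw [Function.iterate_succ_apply']
    by_cases hA : Adm d c
    · rw [coeff_of_adm _ hA]
      refine Finset.sum_eq_zero fun p hp => ?_
      rw [mem_antidiagonal] at hp
      dsimp only at hp
      by_cases hq : p.1 = 0
      · rw [hq, h, ← Module.End.pow_apply, map_zero, map_zero, LinearMap.zero_apply, smul_zero]
      · have h1 : p.1.degree + p.2.degree = c.degree := by rw [← hp, map_add]
        have h2 : p.1.degree ≠ 0 := by rwa [Ne, Finsupp.degree_eq_zero_iff]
        rw [ih p.2 (by omega), map_zero, smul_zero]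
    · exact dif_neg hA

/-- The series `f(ad F) G` converges if `F` has no constant term. -/
theorem summable_opSeries [LieSuperalgebra K 𝔤] (f : PowerSeries K) {F : Series K d 𝔤}
    (h : F.coeff 0 = 0) (G : Series K d 𝔤) :
    Summable fun n : ℕ => (PowerSeries.coeff n f • (ad F)^[n] G : Series K d 𝔤) := by
  intro m
  refine (Set.finite_Iic m.1.degree).subset fun n hn => ?_
  by_contra hlt
  apply hn
  have := coeff_ad_iterate_eq_zero h G n m.1 (by simpa using hlt)
  rw [coeff_of_adm _ m.2] at this
  exact (congrArg (PowerSeries.coeff n f • ·) this).trans (smul_zero _)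

end Operators

end Series

/-- The power series `e^{-t}`. -/
noncomputable def expNeg (K : Type*) [Field K] : PowerSeries K :=
  PowerSeries.mk fun n => (-1) ^ n * ((n.factorial : K))⁻¹

/-- The power series `(e^{-t} - 1) / t`. -/
noncomputable def expNegQuot (K : Type*) [Field K] : PowerSeries K :=
  PowerSeries.mk fun n => (-1) ^ (n + 1) * (((n + 1).factorial : K))⁻¹

theorem X_mul_expNegQuot (K : Type*) [Field K] :
    PowerSeries.X * expNegQuot K = expNeg K - 1 := by
  ext n
  cases n with
  | zero => simp [expNeg]
  | succ n => simp [expNeg, expNegQuot, PowerSeries.coeff_succ_X_mul, PowerSeries.coeff_one]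

/-- The power series `t / (e^{-t} - 1)`. -/
noncomputable def tDivExpNeg (K : Type*) [Field K] : PowerSeries K := (expNegQuot K)⁻¹

theorem expNegQuot_mul_tDivExpNeg (K : Type*) [Field K] :
    expNegQuot K * tDivExpNeg K = 1 :=
  PowerSeries.mul_inv_cancel _ (by simp [expNegQuot])

end SuperSeries

open SuperSeries

/-!
Write `D = ad XP`, `E(t) = (e^{-t} - 1) / t` and `Q(t) = 1 / E(t)`. The factorization
`e^{εg} e^{XP} = e^{XP + εA} e^{εB}` only has to be compared to first order in `ε`, because the
ideal of the series divisible by `ε` has square zero (`epsIdeal`, `mul_eq_zero_of_mem_epsIdeal`).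
In the enveloping superalgebra, conjugation by `e^{XP}` gives `(εg) e^{XP} = e^{XP} ε e^{-D} g`
(`mul_exp_eq_exp_mul`), the derivative of the exponential gives
`e^{XP + εA} = e^{XP} (1 - ε E(D) A)` (`exp_add_eq`), and `e^{εg} = 1 + εg`. Hence the identity
amounts to the splitting `e^{-D} g = -E(D) A + B`, with `A` in `A ⊗̂ 𝔤₋` and `B` in `A ⊗̂ 𝔥`
(`exp_lsmul_eps_mul_exp`).

Projecting the splitting to `𝔤₋` kills `B` and determines `A`; applying `Q(D)` and projecting to
`𝔥` kills `A` and determines `B`. Conversely, the elements defined in this way satisfy the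
splitting (`eq_opSeries_add_of_symm`). The operators to be inverted are compressions of power
series in `D` with nonzero constant term. As `XP` has no constant term, `D` raises the degree of
series, so these operators are nonzero scalars up to terms raising the degree, and they are
bijective because the degree filtration is complete (`bijective_of_sub_smul_mem`). All
identities between power series in operators are proved modulo each step of this filtration.

The series `XP` is even. Therefore `ad XP` becomes an ordinary commutator in `A ⊗̂ U(𝔤)`
(`map_ι_ad`), and it commutes with the parity operator. It also commutes with the projection to
the series without `ε₀, ε₁`, since `XP` does not contain them. Both operators act diagonally on
the monomials (`twist`), and the compressions and their inverses inherit these commutation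
relations (`symm_twist`), so that the two maps are even and take values in `ε`-free series.
-/

namespace SuperSeries

set_option linter.unusedSectionVars false

open Finset.HasAntidiagonal (antidiagonal mem_antidiagonal)

namespace Series

/-! ### The degree filtration and power series in operators raising the degree -/

section Filtration

variable {K I : Type*} [Field K] {d : I → Fin 2} {W W' : Type*}
  [AddCommGroup W] [Module K W] [AddCommGroup W'] [Module K W']

variable (K d W) in
/-- The series all of whose monomials have total degree at least `n`. These submodules form a
separated and complete filtration of `A ⊗̂ W`. -/
def degGE (n : ℕ) : Submodule K (Series K d W) where
  carrier := {F | ∀ m : Mon d, m.1.degree < n → F m = 0}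
  add_mem' {F G} hF hG m hm := by
    change F m + G m = 0
    rw [hF m hm, hG m hm, add_zero]
  zero_mem' _ _ := rfl
  smul_mem' c F hF m hm := by
    change c • F m = 0
    rw [hF m hm, smul_zero]

theorem add_apply (F G : Series K d W) (m : Mon d) : (F + G) m = F m + G m := rfl

theorem sub_apply (F G : Series K d W) (m : Mon d) : (F - G) m = F m - G m := rfl

theorem neg_apply (F : Series K d W) (m : Mon d) : (-F) m = -F m := rfl

theorem smul_apply (c : K) (F : Series K d W) (m : Mon d) : (c • F) m = c • F m := rfl

theorem zero_apply (m : Mon d) : (0 : Series K d W) m = 0 := rfl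

variable (K) in
/-- Taking the coefficient at a monomial, as a linear map. -/
def evalₗ (m : Mon d) : Series K d W →ₗ[K] W where
  toFun F := F m
  map_add' _ _ := rfl
  map_smul' _ _ := rfl

theorem sum_apply {α : Type*} (s : Finset α) (F : α → Series K d W) (m : Mon d) :
    (∑ a ∈ s, F a) m = ∑ a ∈ s, F a m :=
  map_sum (evalₗ K m) F s

theorem degGE_anti {a b : ℕ} (h : a ≤ b) : degGE K d W b ≤ degGE K d W a :=
  fun _ hF m hm => hF m (hm.trans_le h)

theorem mem_degGE_zero (F : Series K d W) : F ∈ degGE K d W 0 :=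
  fun _ hm => absurd hm (Nat.not_lt_zero _)

theorem eq_of_forall_sub_mem_degGE {F G : Series K d W} (h : ∀ n, F - G ∈ degGE K d W n) :
    F = G :=
  funext fun m => sub_eq_zero.1 (h (m.1.degree + 1) m (Nat.lt_succ_self _))

theorem tsum_sub_sum_range_mem {F : ℕ → Series K d W} (h : ∀ i, F i ∈ degGE K d W i) (n : ℕ) :
    tsum F - ∑ i ∈ Finset.range n, F i ∈ degGE K d W n := by
  intro m hm
  rw [sub_apply, sum_apply, sub_eq_zero]
  refine finsum_eq_sum_of_support_subset _ fun i hi => ?_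
  by_contra hin
  exact hi (h i m (hm.trans_le (by simpa using hin)))

/-- An operator which raises the degree of series by at least one. -/
def Raises (T : Module.End K (Series K d W)) : Prop :=
  ∀ n, ∀ F ∈ degGE K d W n, T F ∈ degGE K d W (n + 1)

/-- A linear map which does not lower the degree of series. -/
def Filtered (T : Series K d W →ₗ[K] Series K d W') : Prop :=
  ∀ n, ∀ F ∈ degGE K d W n, T F ∈ degGE K d W' n

theorem Raises.neg {T : Module.End K (Series K d W)} (hT : Raises T) : Raises (-T) :=
  fun n F hF => neg_mem (hT n F hF)

theorem Raises.add {T S : Module.End K (Series K d W)} (hT : Raises T) (hS : Raises S) :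
    Raises (T + S) :=
  fun n F hF => add_mem (hT n F hF) (hS n F hF)

theorem Raises.pow_mem {T : Module.End K (Series K d W)} (hT : Raises T) {k : ℕ}
    {F : Series K d W} (hF : F ∈ degGE K d W k) (n : ℕ) : (T ^ n) F ∈ degGE K d W (n + k) := by
  induction n with
  | zero => simpa using hF
  | succ n ih =>
    rw [pow_succ', Module.End.mul_apply, Nat.add_right_comm]
    exact hT _ _ ih

theorem opSeries_eq_tsum (f : PowerSeries K) (T : Module.End K (Series K d W))
    (F : Series K d W) :
    opSeries f T F = tsum fun n => (PowerSeries.coeff n f • (T ^ n) F : Series K d W) := by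
  simp only [opSeries, Module.End.pow_apply]

theorem opSeries_sub_sum_range_mem (f : PowerSeries K) {T : Module.End K (Series K d W)}
    (hT : Raises T) (F : Series K d W) (n : ℕ) :
    opSeries f T F - ∑ i ∈ Finset.range n, PowerSeries.coeff i f • (T ^ i) F
      ∈ degGE K d W n := by
  rw [opSeries_eq_tsum]
  exact tsum_sub_sum_range_mem
    (fun i => Submodule.smul_mem _ _ (hT.pow_mem (mem_degGE_zero F) i)) n

/-- A filtered linear map intertwining two operators intertwines power series in them. -/
theorem map_opSeries {Φ : Series K d W →ₗ[K] Series K d W'} (hΦ : Filtered Φ)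
    {T : Module.End K (Series K d W)} {S : Module.End K (Series K d W')} (hT : Raises T)
    (hS : Raises S) (h : ∀ F, Φ (T F) = S (Φ F)) (f : PowerSeries K) (F : Series K d W) :
    Φ (opSeries f T F) = opSeries f S (Φ F) := by
  have hpow : ∀ n F, Φ ((T ^ n) F) = (S ^ n) (Φ F) := by
    intro n
    induction n with
    | zero => simp
    | succ n ih =>
      intro F
      rw [pow_succ, pow_succ, Module.End.mul_apply, Module.End.mul_apply, ih, h]
  refine eq_of_forall_sub_mem_degGE fun n => ?_
  have h1 := hΦ n _ (opSeries_sub_sum_range_mem f hT F n)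
  have h2 := opSeries_sub_sum_range_mem f hS (Φ F) n
  simp only [map_sub, map_sum, map_smul, hpow] at h1
  simpa using sub_mem h1 h2

/-- `F ↦ f(T) F` is a linear map. -/
noncomputable def opSeriesₗ (f : PowerSeries K) {T : Module.End K (Series K d W)}
    (hT : Raises T) : Module.End K (Series K d W) where
  toFun := opSeries f T
  map_add' F G := by
    refine eq_of_forall_sub_mem_degGE fun n => ?_
    have h1 := opSeries_sub_sum_range_mem f hT F n
    have h2 := opSeries_sub_sum_range_mem f hT G n
    have h3 := opSeries_sub_sum_range_mem f hT (F + G) n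
    simp only [map_add, smul_add, Finset.sum_add_distrib] at h3
    convert sub_mem h3 (add_mem h1 h2) using 1
    abel
  map_smul' c F :=
    (map_opSeries (Φ := c • LinearMap.id) (fun n F hF => Submodule.smul_mem _ c hF) hT hT
      (fun F => by simp) f F).symm

theorem opSeriesₗ_apply (f : PowerSeries K) {T : Module.End K (Series K d W)} (hT : Raises T)
    (F : Series K d W) : opSeriesₗ f hT F = opSeries f T F := rfl

theorem sum_antidiagonal_mem_degGE (f g : PowerSeries K) {T S : Module.End K (Series K d W)}
    (hT : Raises T) (hS : Raises S) (F : Series K d W) (n : ℕ) :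
    (∑ p ∈ antidiagonal n, (PowerSeries.coeff p.1 f * PowerSeries.coeff p.2 g) •
      (T ^ p.1) ((S ^ p.2) F)) ∈ degGE K d W n := by
  refine Submodule.sum_mem _ fun p hp => Submodule.smul_mem _ _ ?_
  rw [mem_antidiagonal] at hp
  exact hp ▸ hT.pow_mem (hS.pow_mem (mem_degGE_zero F) p.2) p.1

/-- The composition of power series in two operators is given by a Cauchy product. -/
theorem opSeries_opSeries (f g : PowerSeries K) {T S : Module.End K (Series K d W)}
    (hT : Raises T) (hS : Raises S) (F : Series K d W) :
    opSeries f T (opSeries g S F) = tsum fun n => (∑ p ∈ antidiagonal n,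
      (PowerSeries.coeff p.1 f * PowerSeries.coeff p.2 g) • (T ^ p.1) ((S ^ p.2) F) :
        Series K d W) := by
  refine eq_of_forall_sub_mem_degGE fun n => ?_
  have h1 := opSeries_sub_sum_range_mem f hT (opSeries g S F) n
  have h2 := tsum_sub_sum_range_mem (sum_antidiagonal_mem_degGE f g hT hS F) n
  -- the remainder of the inner series of order `n - i` is raised to order `n` by `T ^ i`
  have h3 : ∑ i ∈ Finset.range n, PowerSeries.coeff i f • (T ^ i) (opSeries g S F -
      ∑ j ∈ Finset.range (n - i), PowerSeries.coeff j g • (S ^ j) F) ∈ degGE K d W n := by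
    refine Submodule.sum_mem _ fun i hi => Submodule.smul_mem _ _ ?_
    have := hT.pow_mem (opSeries_sub_sum_range_mem g hS F (n - i)) i
    rwa [Nat.add_sub_cancel' (Finset.mem_range.1 hi).le] at this
  have h4 : ∑ m ∈ Finset.range n, ∑ p ∈ antidiagonal m,
      (PowerSeries.coeff p.1 f * PowerSeries.coeff p.2 g) • (T ^ p.1) ((S ^ p.2) F) =
      ∑ i ∈ Finset.range n, PowerSeries.coeff i f • (T ^ i)
        (∑ j ∈ Finset.range (n - i), PowerSeries.coeff j g • (S ^ j) F) := by
    simp only [map_sum, map_smul, Finset.smul_sum, smul_smul]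
    rw [← Finset.sum_range_diag_flip]
    exact Finset.sum_congr rfl fun m _ => Finset.Nat.sum_antidiagonal_eq_sum_range_succ
      (fun i j => (PowerSeries.coeff i f * PowerSeries.coeff j g) • (T ^ i) ((S ^ j) F)) m
  simp only [map_sub, smul_sub, Finset.sum_sub_distrib] at h3
  rw [h4] at h2
  convert sub_mem (add_mem h1 h3) h2 using 1
  abel

theorem opSeries_mul (f g : PowerSeries K) {T : Module.End K (Series K d W)}
    (hT : Raises T) (F : Series K d W) :
    opSeries (f * g) T F = opSeries f T (opSeries g T F) := by
  rw [opSeries_opSeries f g hT hT, opSeries_eq_tsum]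
  congr 1
  funext n
  rw [PowerSeries.coeff_mul, Finset.sum_smul]
  refine Finset.sum_congr rfl fun p hp => ?_
  rw [← Module.End.mul_apply, ← pow_add, mem_antidiagonal.1 hp]

theorem opSeries_sub_smul_mem (f : PowerSeries K) {T : Module.End K (Series K d W)}
    (hT : Raises T) {F : Series K d W} {n : ℕ} (hF : F ∈ degGE K d W n) :
    opSeries f T F - PowerSeries.constantCoeff f • F ∈ degGE K d W (n + 1) := by
  intro m hm
  have h := opSeries_sub_sum_range_mem f hT F (n + 1) m hm
  have h' : (∑ i ∈ Finset.range n, PowerSeries.coeff (i + 1) f • (T ^ (i + 1)) F)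
      ∈ degGE K d W (n + 1) :=
    Submodule.sum_mem _ fun i _ => Submodule.smul_mem _ _
      (degGE_anti (by omega) (hT.pow_mem hF (i + 1)))
  rw [Finset.sum_range_succ', ← sub_sub, sub_right_comm, sub_apply, h' m hm, sub_zero] at h
  simpa using h

theorem opSeries_one {T : Module.End K (Series K d W)} (F : Series K d W) :
    opSeries 1 T F = F := by
  funext m
  refine (finsum_eq_single _ 0 fun n hn => ?_).trans ?_
  · change PowerSeries.coeff n (1 : PowerSeries K) • (T^[n] F) m = 0
    rw [PowerSeries.coeff_one, if_neg hn, zero_smul]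
  · change PowerSeries.coeff 0 (1 : PowerSeries K) • F m = F m
    rw [PowerSeries.coeff_zero_one, one_smul]

/-- An operator whose leading term is a nonzero scalar is bijective, by completeness of the
degree filtration. -/
theorem bijective_of_sub_smul_mem {T : Module.End K (Series K d W)} {c : K} (hc : c ≠ 0)
    (h : ∀ n, ∀ F ∈ degGE K d W n, T F - c • F ∈ degGE K d W (n + 1)) :
    Function.Bijective T := by
  constructor
  · refine (injective_iff_map_eq_zero T).2 fun F hF => ?_
    have hmem : ∀ n, F ∈ degGE K d W n := by
      intro n
      induction n with
      | zero => exact mem_degGE_zero F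
      | succ n ih =>
        have := h n F ih
        rw [hF, zero_sub, neg_mem_iff] at this
        exact (Submodule.smul_mem_iff _ hc).1 this
    exact eq_of_forall_sub_mem_degGE fun n => by simpa using hmem n
  · intro y
    -- successive approximations `S (n + 1) = S n + c⁻¹ (y - T (S n))`
    let S : ℕ → Series K d W := fun n => n.rec 0 fun _ s => s + c⁻¹ • (y - T s)
    have hS : ∀ n, S (n + 1) = S n + c⁻¹ • (y - T (S n)) := fun n => rfl
    have hy : ∀ n, y - T (S n) ∈ degGE K d W n := by
      intro n
      induction n with
      | zero => exact mem_degGE_zero _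
      | succ n ih =>
        have := neg_mem (h n _ (Submodule.smul_mem _ c⁻¹ ih))
        rw [smul_smul, mul_inv_cancel₀ hc, one_smul] at this
        rw [hS, map_add]
        convert this using 1
        abel
    have hstep : ∀ n k, S (n + k) - S n ∈ degGE K d W n := by
      intro n k
      induction k with
      | zero => simp
      | succ k ih =>
        have := Submodule.smul_mem _ c⁻¹ (degGE_anti (Nat.le_add_right n k) (hy (n + k)))
        rw [← add_assoc, hS]
        convert add_mem ih this using 1
        abel
    let G : Series K d W := fun m => S (m.1.degree + 1) m
    have hG : ∀ n, G - S n ∈ degGE K d W n := by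
      intro n m hm
      obtain ⟨k, rfl⟩ := Nat.exists_eq_add_of_le (Nat.succ_le_of_lt hm)
      have := hstep (m.1.degree + 1) k m (Nat.lt_succ_self _)
      rw [sub_apply, sub_eq_zero] at this ⊢
      exact this.symm
    refine ⟨G, eq_of_forall_sub_mem_degGE fun n => ?_⟩
    have h1 := degGE_anti (Nat.le_succ n) (h n _ (hG n))
    have h2 := Submodule.smul_mem _ c (hG n)
    have h3 := hy n
    rw [map_sub] at h1
    convert sub_mem (add_mem h1 h2) h3 using 1
    abel

end Filtration

/-! ### Bilinear convolution and coefficientwise maps -/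

section Convolution

variable {K I : Type*} [Field K] [LinearOrder I] {d : I → Fin 2} {W₁ W₂ W₃ : Type*}
  [AddCommGroup W₁] [Module K W₁] [AddCommGroup W₂] [Module K W₂] [AddCommGroup W₃] [Module K W₃]

theorem coeff_smul (c : K) (F : Series K d W₁) (m : Var I →₀ ℕ) :
    (c • F).coeff m = c • F.coeff m := by
  unfold coeff
  split_ifs
  · rfl
  · simp

theorem coeff_map (f : W₁ →ₗ[K] W₂) (F : Series K d W₁) (m : Var I →₀ ℕ) :
    (map f F).coeff m = f (F.coeff m) := by
  unfold coeff
  split_ifs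
  · rfl
  · simp

theorem coeff_eq_zero_of_mem_degGE {n : ℕ} {F : Series K d W₁} (hF : F ∈ degGE K d W₁ n)
    {m : Var I →₀ ℕ} (hm : m.degree < n) : F.coeff m = 0 := by
  unfold coeff
  split_ifs with h
  · exact hF ⟨m, h⟩ hm
  · rfl

theorem filtered_map (f : W₁ →ₗ[K] W₂) : Filtered (map (d := d) f) := fun n F hF m hm => by
  change f (F m) = 0
  rw [hF m hm, map_zero]

theorem iterate_par_zero [Superspace K W₁] (n : ℕ) : (par K)^[n] (0 : W₁) = 0 := by
  rw [← Module.End.pow_apply, map_zero]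

theorem iterate_par_smul [Superspace K W₁] (n : ℕ) (c : K) (x : W₁) :
    (par K)^[n] (c • x) = c • (par K)^[n] x := by
  rw [← Module.End.pow_apply, map_smul, Module.End.pow_apply]

variable [Superspace K W₁]

theorem conv_apply (β : W₁ →ₗ[K] W₂ →ₗ[K] W₃) (F : Series K d W₁) (G : Series K d W₂)
    (c : Mon d) : conv β F G c = ∑ p ∈ antidiagonal c.1, (-1 : K) ^ inversions d p.1 p.2 •
      β ((par K)^[oddDeg d p.2] (F.coeff p.1)) (G.coeff p.2) := rfl

/-- The convolution with a fixed left factor, as a linear map. -/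
noncomputable def convₗ (β : W₁ →ₗ[K] W₂ →ₗ[K] W₃) (F : Series K d W₁) :
    Series K d W₂ →ₗ[K] Series K d W₃ where
  toFun := conv β F
  map_add' G H := funext fun c => by
    simp only [conv_apply, add_apply, coeff_add, map_add, smul_add, Finset.sum_add_distrib]
  map_smul' a G := funext fun c => by
    simp only [conv_apply, smul_apply, coeff_smul, map_smul, RingHom.id_apply, Finset.smul_sum]
    exact Finset.sum_congr rfl fun p _ => smul_comm _ _ _

theorem conv_mem_degGE (β : W₁ →ₗ[K] W₂ →ₗ[K] W₃) {a b : ℕ} {F : Series K d W₁}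
    {G : Series K d W₂} (hF : F ∈ degGE K d W₁ a) (hG : G ∈ degGE K d W₂ b) :
    conv β F G ∈ degGE K d W₃ (a + b) := by
  intro c hc
  rw [conv_apply]
  refine Finset.sum_eq_zero fun p hp => ?_
  have hdeg : p.1.degree + p.2.degree = c.1.degree := by
    rw [← mem_antidiagonal.1 hp, map_add]
  rcases lt_or_ge p.1.degree a with h | h
  · rw [coeff_eq_zero_of_mem_degGE hF h, iterate_par_zero, map_zero, LinearMap.zero_apply,
      smul_zero]
  · rw [coeff_eq_zero_of_mem_degGE hG (by omega), map_zero, smul_zero]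

theorem filtered_convₗ (β : W₁ →ₗ[K] W₂ →ₗ[K] W₃) (F : Series K d W₁) :
    Filtered (convₗ β F) := fun n _ hG => by
  have := conv_mem_degGE β (mem_degGE_zero F) hG
  rwa [zero_add] at this

theorem raises_convₗ (β : W₁ →ₗ[K] W₂ →ₗ[K] W₂) {F : Series K d W₁}
    (hF : F ∈ degGE K d W₁ 1) : Raises (convₗ β F) := fun n _ hG => by
  have := conv_mem_degGE β hF hG
  rwa [add_comm] at this

theorem par_par (x : W₁) : par K (par K x) = x := Superspace.parity_parity x

/-- The coefficients of an even series are homogeneous. -/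
theorem iterate_par_coeff {F : Series K d W₁} (hF : F.parity = F) (n : ℕ) (m : Var I →₀ ℕ) :
    (par K)^[n] (F.coeff m) = (-1 : K) ^ (n * oddDeg d m) • F.coeff m := by
  have h1 : par K (F.coeff m) = (-1 : K) ^ oddDeg d m • F.coeff m := by
    by_cases hm : Adm d m
    · have := congrFun hF ⟨m, hm⟩
      rw [coeff_of_adm F hm]
      conv_rhs => rw [← this]
      change _ = (-1 : K) ^ oddDeg d m • ((-1 : K) ^ oddDeg d m • _)
      rw [smul_smul, ← pow_add, Even.neg_one_pow ⟨_, rfl⟩, one_smul]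
    · simp [coeff, hm]
  induction n with
  | zero => simp
  | succ n ih =>
    rw [Function.iterate_succ_apply', ih, map_smul, h1, smul_smul, ← pow_add]
    congr 2
    ring

/-- The sign rule for exchanging two monomials without common odd variables. -/
theorem inversions_add_inversions (a b : Var I →₀ ℕ)
    (h : ∀ v, vpar d v = 1 → a v = 0 ∨ b v = 0) :
    inversions d a b + inversions d b a = oddDeg d a * oddDeg d b := by
  induction a using Finsupp.induction_linear with
  | zero => simp [inversions_zero_left, inversions_zero_right, oddDeg_zero]
  | add f g hf hg =>
    have hf' := hf fun v hv => (h v hv).imp_left fun h0 => by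
      rw [Finsupp.add_apply] at h0
      omega
    have hg' := hg fun v hv => (h v hv).imp_left fun h0 => by
      rw [Finsupp.add_apply] at h0
      omega
    rw [inversions_add_left, inversions_add_right, oddDeg_add, add_mul, ← hf', ← hg']
    ring
  | single v n =>
    have e1 : inversions d (Finsupp.single v n) b = b.sum fun w k =>
        if w < v then (vpar d v : ℕ) * n * ((vpar d w : ℕ) * k) else 0 :=
      Finsupp.sum_single_index (by simp)
    have e2 : inversions d b (Finsupp.single v n) = b.sum fun w k =>
        if v < w then (vpar d w : ℕ) * k * ((vpar d v : ℕ) * n) else 0 :=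
      Finsupp.sum_congr fun w _ => Finsupp.sum_single_index (by simp)
    have e3 : oddDeg d (Finsupp.single v n) = (vpar d v : ℕ) * n :=
      Finsupp.sum_single_index (by simp)
    rw [e1, e2, e3, oddDeg, Finsupp.mul_sum, ← Finsupp.sum_add]
    refine Finsupp.sum_congr fun w _ => ?_
    rcases lt_trichotomy w v with hw | rfl | hw
    · rw [if_pos hw, if_neg hw.asymm, add_zero]
    · rw [if_neg (lt_irrefl _)]
      rcases (by omega : vpar d w = 0 ∨ vpar d w = 1) with h0 | h1
      · simp [h0]
      · rcases h w h1 with h2 | h2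
        · rw [Finsupp.single_eq_same] at h2
          simp [h2]
        · simp [h2]
    · rw [if_neg hw.asymm, if_pos hw]
      ring

theorem neg_one_pow_inversions {a b c : Var I →₀ ℕ} (hc : Adm d c) (h : a + b = c) :
    (-1 : K) ^ inversions d b a =
      (-1 : K) ^ inversions d a b * (-1 : K) ^ (oddDeg d b * oddDeg d a) := by
  have key := inversions_add_inversions (d := d) a b fun v hv => by
    have := hc v (Or.inr hv)
    rw [← h, Finsupp.add_apply] at this
    omega
  rw [mul_comm (oddDeg d b), ← key, ← pow_add, ← add_assoc, pow_add, Even.neg_one_pow ⟨_, rfl⟩,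
    one_mul]

end Convolution

/-! ### Diagonal operators: the parity and the projection to the `ε`-free series -/

section Twist

variable {K I : Type*} [Field K] {d : I → Fin 2} {W W' : Type*}
  [AddCommGroup W] [Module K W] [AddCommGroup W'] [Module K W']

/-- The operator `∑ₘ m ⊗ wₘ ↦ ∑ₘ s(m) m ⊗ p(wₘ)`. -/
def twist (s : Mon d → K) (p : W →ₗ[K] W) : Module.End K (Series K d W) where
  toFun F := fun m => s m • p (F m)
  map_add' F G := funext fun m => by
    change s m • p (F m + G m) = s m • p (F m) + s m • p (G m)
    rw [map_add, smul_add]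
  map_smul' c F := funext fun m => by
    simp only [smul_apply, map_smul, RingHom.id_apply]
    exact smul_comm _ _ _

theorem twist_apply (s : Mon d → K) (p : W →ₗ[K] W) (F : Series K d W) (m : Mon d) :
    twist s p F m = s m • p (F m) := rfl

theorem filtered_twist (s : Mon d → K) (p : W →ₗ[K] W) : Filtered (twist s p) :=
  fun n F hF m hm => by rw [twist_apply, hF m hm, map_zero, smul_zero]

theorem map_twist (s : Mon d → K) {p : W →ₗ[K] W} {p' : W' →ₗ[K] W'} {f : W →ₗ[K] W'}
    (h : ∀ w, f (p w) = p' (f w)) (F : Series K d W) :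
    map f (twist s p F) = twist s p' (map f F) := funext fun m => by
  change f (s m • p (F m)) = s m • p' (f (F m))
  rw [map_smul, h]

theorem twist_const [LinearOrder I] (s : Mon d → K) {p : W →ₗ[K] W} (hs : s ⟨0, adm_zero⟩ = 1)
    (w : W) :
    twist s p (const w : Series K d W) = const (p w) := funext fun m => by
  rw [twist_apply]
  unfold const monomial
  split_ifs with h
  · rw [show m = ⟨0, adm_zero⟩ from Subtype.ext h, hs, one_smul]
  · rw [map_zero, smul_zero]

open Classical in
/-- The indicator function of the monomials without `ε₀` and `ε₁`. -/
noncomputable def epsFreeInd (m : Mon d) : K := if ∃ k, m.1 (Var.eps k) ≠ 0 then 0 else 1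

theorem epsFree_iff_twist (F : Series K d W) :
    F.EpsFree ↔ twist epsFreeInd LinearMap.id F = F := by
  constructor
  · intro h
    funext m
    rw [twist_apply, epsFreeInd]
    split_ifs with hm
    · rw [h m hm, map_zero, smul_zero]
    · rw [one_smul, LinearMap.id_apply]
  · intro h m hm
    rw [← h, twist_apply, epsFreeInd, if_pos hm, zero_smul]

variable [LinearOrder I] [Superspace K W]

/-- A criterion for a convolution operator to commute with a diagonal operator. -/
theorem conv_twist {β : W →ₗ[K] W →ₗ[K] W} {F : Series K d W} (hF : F.parity = F)
    {s : Mon d → K} {p : W →ₗ[K] W}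
    (h : ∀ a b c : Mon d, a.1 + b.1 = c.1 → ∀ y, s c • p (β (F a) y) = s b • β (F a) (p y))
    (G : Series K d W) : conv β F (twist s p G) = twist s p (conv β F G) := by
  funext c
  rw [twist_apply, conv_apply, conv_apply, map_sum, Finset.smul_sum]
  refine Finset.sum_congr rfl fun q hq => ?_
  rw [mem_antidiagonal] at hq
  have h1 : Adm d q.1 := adm_of_le (hq ▸ le_self_add) c.2
  have h2 : Adm d q.2 := adm_of_le (hq ▸ le_add_self) c.2
  have := h ⟨q.1, h1⟩ ⟨q.2, h2⟩ c hq (G ⟨q.2, h2⟩)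
  rw [iterate_par_coeff hF, coeff_of_adm _ h1, coeff_of_adm _ h2, coeff_of_adm _ h2]
  change _ • β _ (s ⟨q.2, h2⟩ • p (G ⟨q.2, h2⟩)) = _
  simp only [map_smul, LinearMap.smul_apply]
  rw [smul_comm (s c), smul_comm (s c), this]
  simp only [smul_smul]
  congr 1
  ring

end Twist

section AdTwist

variable {K I : Type*} [Field K] [LinearOrder I] {d : I → Fin 2} {𝔤 : Type*}
  [AddCommGroup 𝔤] [Module K 𝔤] [LieSuperalgebra K 𝔤]

theorem ad_parity {F : Series K d 𝔤} (hF : F.parity = F) (G : Series K d 𝔤) :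
    ad F (twist (fun m => (-1 : K) ^ oddDeg d m.1) (par K) G) =
      twist (fun m => (-1 : K) ^ oddDeg d m.1) (par K) (ad F G) := by
  refine conv_twist hF (fun a b c h y => ?_) G
  have h1 := iterate_par_coeff hF 1 a.1
  rw [coeff_of_adm F a.2, one_mul, Function.iterate_one] at h1
  have h2 : par K (LieSuperalgebra.bracket (K := K) (F a) y) =
      LieSuperalgebra.bracket (K := K) (par K (F a)) (par K y) :=
    LieSuperalgebra.parity_bracket _ _
  change _ • par K (LieSuperalgebra.bracket (K := K) (F a) y) = _
  rw [h2, show par K (F a) = (-1 : K) ^ oddDeg d a.1 • F a from h1, map_smul,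
    LinearMap.smul_apply, smul_smul, ← h, oddDeg_add, pow_add, mul_right_comm, ← pow_add,
    Even.neg_one_pow ⟨_, rfl⟩, one_mul]

theorem ad_epsFree {F : Series K d 𝔤} (hF : F.parity = F) (hε : F.EpsFree)
    (G : Series K d 𝔤) :
    ad F (twist epsFreeInd LinearMap.id G) = twist epsFreeInd LinearMap.id (ad F G) := by
  refine conv_twist hF (fun a b c h y => ?_) G
  by_cases ha : ∃ k, a.1 (Var.eps k) ≠ 0
  · rw [show F a = 0 from hε a ha]
    simp
  · have : (epsFreeInd c : K) = epsFreeInd b := by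
      simp only [ne_eq, not_exists, not_not] at ha
      simp only [epsFreeInd, ← h, Finsupp.add_apply, ha, zero_add]
    rw [this]
    rfl

end AdTwist

/-! ### The series `∑ᵢ cᵢ ⊗ Pᵢ` -/

section Pairing

variable {K I : Type*} [Field K] [LinearOrder I] {d : I → Fin 2} {𝔤 : Type*}
  [AddCommGroup 𝔤] [Module K 𝔤]

theorem pairing_apply (c : I → Series K d K) (P : I → 𝔤) (m : Mon d) :
    pairing c P m = ∑ᶠ i, (c i m : K) • P i := rfl

theorem X_apply (i : I) (m : Mon d) [Decidable (m.1 = Finsupp.single (Var.X i) 1)] :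
    (X i : Series K d K) m = if m.1 = Finsupp.single (Var.X i) 1 then (1 : K) else (0 : K) := by
  unfold X monomial
  congr

theorem single_varX_injective :
    Function.Injective fun i : I => Finsupp.single (Var.X i) (1 : ℕ) := by
  intro i j h
  have := (Finsupp.single_left_inj one_ne_zero).1 h
  exact Sum.inr_injective (toLex.injective this)

theorem finite_support_X_smul (P : I → 𝔤) (m : Mon d) :
    Function.HasFiniteSupport fun i => ((X i : Series K d K) m : K) • P i := by
  classical
  refine Set.Subsingleton.finite fun i hi j hj => ?_
  rw [Function.mem_support, X_apply] at hi hj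
  have hi' : m.1 = Finsupp.single (Var.X i) 1 := by
    by_contra h
    rw [if_neg h, zero_smul] at hi
    exact hi rfl
  have hj' : m.1 = Finsupp.single (Var.X j) 1 := by
    by_contra h
    rw [if_neg h, zero_smul] at hj
    exact hj rfl
  exact single_varX_injective (hi'.symm.trans hj')

theorem pairing_X_apply (P : I → 𝔤) (m : Mon d) :
    (∃ i, m.1 = Finsupp.single (Var.X i) 1 ∧
      pairing (fun i => (X i : Series K d K)) P m = P i) ∨
    pairing (fun i => (X i : Series K d K)) P m = 0 := by
  classical
  by_cases h : ∃ i, m.1 = Finsupp.single (Var.X i) 1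
  · obtain ⟨i, hi⟩ := h
    refine Or.inl ⟨i, hi, ?_⟩
    rw [pairing_apply, finsum_eq_single _ i, X_apply, if_pos hi, one_smul]
    intro j hj
    rw [X_apply, if_neg, zero_smul]
    intro hj'
    exact hj (single_varX_injective (hj'.symm.trans hi))
  · refine Or.inr ?_
    rw [pairing_apply]
    refine (finsum_congr fun i => ?_).trans finsum_zero
    rw [X_apply, if_neg (fun hi => h ⟨i, hi⟩), zero_smul]

theorem parity_pairing_X [Superspace K 𝔤] {P : I → 𝔤} (hP : ∀ i, IsHomog K (d i) (P i)) :
    (pairing (fun i => (X i : Series K d K)) P).parity = pairing (fun i => X i) P := by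
  funext m
  change (-1 : K) ^ oddDeg d m.1 • par K (pairing (fun i => (X i : Series K d K)) P m) = _
  rcases pairing_X_apply (K := K) P m with ⟨i, hi, h⟩ | h
  · have : oddDeg d m.1 = (d i : ℕ) := by
      rw [hi, oddDeg, Finsupp.sum_single_index (by simp), mul_one]
      rfl
    rw [h, hP i, this, smul_smul, ← pow_add, Even.neg_one_pow ⟨_, rfl⟩, one_smul]
  · rw [h, map_zero, smul_zero]

theorem epsFree_pairing_X (P : I → 𝔤) :
    (pairing (fun i => (X i : Series K d K)) P).EpsFree := by
  rintro m ⟨k, hk⟩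
  rcases pairing_X_apply (K := K) P m with ⟨i, hi, -⟩ | h
  · refine absurd ?_ hk
    rw [hi, Finsupp.single_apply, if_neg]
    intro h
    exact Sum.inr_ne_inl (toLex.injective h)
  · exact h

theorem pairing_X_mem_degGE (P : I → 𝔤) :
    pairing (fun i => (X i : Series K d K)) P ∈ degGE K d 𝔤 1 := by
  intro m hm
  rcases pairing_X_apply (K := K) P m with ⟨i, hi, -⟩ | h
  · rw [hi, Finsupp.degree_single] at hm
    omega
  · exact h

theorem finite_support_coord_smul {V : Submodule K 𝔤} (P : Module.Basis I K V) (v : V) :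
    Function.HasFiniteSupport fun i => P.coord i v • (P i : 𝔤) := by
  refine (P.repr v).support.finite_toSet.subset fun i hi => ?_
  rw [Finset.mem_coe, Finsupp.mem_support_iff]
  intro h
  refine hi ?_
  change P.repr v i • (P i : 𝔤) = 0
  rw [h, zero_smul]

theorem finsum_coord_smul {V : Submodule K 𝔤} (P : Module.Basis I K V) (v : V) :
    ∑ᶠ i, P.coord i v • (P i : 𝔤) = v := by
  have h : (Function.support fun i => P.coord i v • (P i : 𝔤)) ⊆ (P.repr v).support := by
    intro i hi
    rw [Finset.mem_coe, Finsupp.mem_support_iff]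
    intro h
    refine hi ?_
    change P.repr v i • (P i : 𝔤) = 0
    rw [h, zero_smul]
  rw [finsum_eq_sum_of_support_subset _ h]
  conv_rhs => rw [← P.linearCombination_repr v, Finsupp.linearCombination_apply, Finsupp.sum]
  rw [AddSubmonoidClass.coe_finsetSum]
  rfl

/-- A series with coefficients in `V` is the pairing of its coordinate series with a basis. -/
theorem pairing_coord {V : Submodule K 𝔤} (P : Module.Basis I K V) (F : Series K d V) :
    pairing (fun i => map (P.coord i) F) (fun i => (P i : 𝔤)) = map V.subtype F :=
  funext fun m => finsum_coord_smul P (F m)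

theorem map_lsmul {W W' : Type*} [AddCommGroup W] [Module K W] [AddCommGroup W'] [Module K W']
    (f : W →ₗ[K] W') (a : Series K d K) (F : Series K d W) :
    map f (lsmul a F) = lsmul a (map f F) := funext fun m => by
  change f (conv _ a F m) = conv _ a (map f F) m
  simp only [conv_apply, map_sum, coeff_map, map_smul, LinearMap.lsmul_apply]

theorem pairing_X_add_eps_mul {V : Submodule K 𝔤} (P : Module.Basis I K V) (a : Series K d K)
    (F : Series K d V) :
    pairing (fun i => X i + a * map (P.coord i) F) (fun i => (P i : 𝔤)) =
      pairing (fun i => X i) (fun i => (P i : 𝔤)) + lsmul a (map V.subtype F) := by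
  have hmul : ∀ i, a * map (P.coord i) F = map (P.coord i) (lsmul a F) := fun i =>
    (map_lsmul (P.coord i) a F).symm
  rw [← map_lsmul, ← pairing_coord P (lsmul a F)]
  simp only [hmul]
  funext m
  refine Eq.trans ?_ (finsum_add_distrib (finite_support_X_smul (fun i => (P i : 𝔤)) m)
    (finite_support_coord_smul P (lsmul a F m)))
  exact finsum_congr fun i => add_smul _ _ _

end Pairing

end Series

/-! ### Commutators in the enveloping superalgebra -/

section Commutator

variable {K 𝔤 : Type*} [Field K] [AddCommGroup 𝔤] [Module K 𝔤] [LieSuperalgebra K 𝔤]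

theorem Env.par_ι (x : 𝔤) : par K (Env.ι K 𝔤 x) = Env.ι K 𝔤 (par K x) :=
  Env.parityHom_ι K 𝔤 x

theorem IsHomog.iterate_par {W : Type*} [AddCommGroup W] [Module K W] [Superspace K W]
    {j : Fin 2} {y : W} (hy : IsHomog K j y) (n : ℕ) :
    (par K)^[n] y = (-1 : K) ^ (n * (j : ℕ)) • y := by
  induction n with
  | zero => simp
  | succ n ih =>
    rw [Function.iterate_succ_apply', ih, map_smul, hy, smul_smul, ← pow_add]
    congr 2
    ring

/-- The supercommutator with a homogeneous element, without a homogeneity assumption on the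
second factor. -/
theorem Env.ι_bracket [CharZero K] {i : Fin 2} {x : 𝔤} (hx : IsHomog K i x) (y : 𝔤) :
    Env.ι K 𝔤 (LieSuperalgebra.bracket (K := K) x y) =
      Env.ι K 𝔤 x * Env.ι K 𝔤 y - (par K)^[i] (Env.ι K 𝔤 y) * Env.ι K 𝔤 x := by
  have hom : ∀ (j : Fin 2) (z : 𝔤), IsHomog K j z →
      Env.ι K 𝔤 (LieSuperalgebra.bracket (K := K) x z) =
        Env.ι K 𝔤 x * Env.ι K 𝔤 z - (par K)^[i] (Env.ι K 𝔤 z) * Env.ι K 𝔤 x := by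
    intro j z hz
    have hz' : IsHomog K j (Env.ι K 𝔤 z) := by
      unfold IsHomog at *
      rw [Env.par_ι, hz, map_smul]
    rw [Env.ι_mul_ι K 𝔤 i j x z hx hz, hz'.iterate_par, smul_mul_assoc, add_sub_cancel_left]
  -- the even and odd parts of `y`
  have h0 : IsHomog K 0 ((2 : K)⁻¹ • (y + par K y)) := by
    simp [IsHomog, Series.par_par, add_comm]
  have h1 : IsHomog K 1 ((2 : K)⁻¹ • (y - par K y)) := by
    simp [IsHomog, Series.par_par, ← smul_neg]
  have hy : y = (2 : K)⁻¹ • (y + par K y) + (2 : K)⁻¹ • (y - par K y) := by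
    rw [← smul_add, add_add_sub_cancel, ← two_smul K y, smul_smul,
      inv_mul_cancel₀ two_ne_zero, one_smul]
  rw [hy, map_add, map_add, map_add, hom 0 _ h0, hom 1 _ h1, ← Module.End.pow_apply,
    ← Module.End.pow_apply, ← Module.End.pow_apply, map_add, mul_add, add_mul]
  abel

end Commutator

namespace Series

/-! ### Multiplication of series and the image of `ad` in `A ⊗̂ U(𝔤)` -/

section RingStructure

variable {K I : Type*} [Field K] [LinearOrder I] {d : I → Fin 2} {B : Type*}
  [Ring B] [Algebra K B] [Superalgebra K B] {W : Type*} [AddCommGroup W] [Module K W]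

theorem mul_apply (F G : Series K d B) (c : Mon d) :
    (F * G) c = ∑ p ∈ antidiagonal c.1, (-1 : K) ^ inversions d p.1 p.2 •
      ((par K)^[oddDeg d p.2] (F.coeff p.1) * G.coeff p.2) := rfl

theorem mul_apply_swap (F G : Series K d B) (c : Mon d) :
    (F * G) c = ∑ p ∈ antidiagonal c.1, (-1 : K) ^ inversions d p.2 p.1 •
      ((par K)^[oddDeg d p.1] (F.coeff p.2) * G.coeff p.1) := by
  rw [mul_apply]
  refine Finset.sum_equiv (Equiv.prodComm _ _) (fun p => ?_) (fun p _ => rfl)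
  rw [mem_antidiagonal, mem_antidiagonal, add_comm]
  rfl

instance : SMulCommClass K (Series K d B) (Series K d B) :=
  ⟨fun a F G => ((convₗ (LinearMap.mul K B) F).map_smul a G).symm⟩

instance : IsScalarTower K (Series K d B) (Series K d B) :=
  ⟨fun a F G => funext fun c => by
    change ((a • F) * G) c = a • (F * G) c
    rw [mul_apply, mul_apply, Finset.smul_sum]
    refine Finset.sum_congr rfl fun p _ => ?_
    rw [coeff_smul, iterate_par_smul, smul_mul_assoc, smul_comm a]⟩

/-- Multiplication by a scalar series agrees with multiplication by its image in `A ⊗̂ B`. -/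
theorem map_lsmul_eq_mul (f : W →ₗ[K] B) (a : Series K d K) (F : Series K d W) :
    map f (lsmul a F) = map (Algebra.linearMap K B) a * map f F := by
  funext c
  rw [map_lsmul, mul_apply]
  refine Finset.sum_congr rfl fun p _ => ?_
  rw [coeff_map (Algebra.linearMap K B), Algebra.linearMap_apply, Algebra.algebraMap_eq_smul_one,
    iterate_par_smul, iterate_par_one, smul_mul_assoc, one_mul, LinearMap.lsmul_apply]
  congr 2
  exact Function.iterate_fixed rfl _

/-- Even series commute with scalar series. -/
theorem commute_map_algebra {F : Series K d B} (hF : F.parity = F) (a : Series K d K) :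
    Commute F (map (Algebra.linearMap K B) a) := by
  refine funext fun c => ?_
  rw [mul_apply, mul_apply_swap]
  refine Finset.sum_congr rfl fun p hp => ?_
  rw [iterate_par_coeff hF, neg_one_pow_inversions c.2 (mem_antidiagonal.1 hp), coeff_map,
    Algebra.linearMap_apply, Algebra.algebraMap_eq_smul_one, iterate_par_smul,
    iterate_par_one]
  simp only [smul_mul_assoc, mul_smul_comm, one_mul, mul_one, smul_smul]
  congr 1
  ring

/-- For even `F`, the operator `ad F` on `A ⊗̂ 𝔤` becomes the commutator with `F` in
`A ⊗̂ U(𝔤)`. -/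
theorem map_ι_ad [CharZero K] {𝔤 : Type*} [AddCommGroup 𝔤] [Module K 𝔤] [LieSuperalgebra K 𝔤]
    {F : Series K d 𝔤} (hF : F.parity = F) (G : Series K d 𝔤) :
    map (Env.ι K 𝔤) (ad F G) = map (Env.ι K 𝔤) F * map (Env.ι K 𝔤) G -
      map (Env.ι K 𝔤) G * map (Env.ι K 𝔤) F := by
  funext c
  rw [sub_apply, mul_apply, mul_apply_swap, ← Finset.sum_sub_distrib]
  change Env.ι K 𝔤 (conv _ F G c) = _
  rw [conv_apply, map_sum]
  refine Finset.sum_congr rfl fun p hp => ?_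
  have hpar : ∀ n, (par K)^[n] (Env.ι K 𝔤 (F.coeff p.1)) =
      (-1 : K) ^ (n * oddDeg d p.1) • Env.ι K 𝔤 (F.coeff p.1) := by
    intro n
    rw [← map_smul, ← iterate_par_coeff hF]
    exact (Function.Semiconj.iterate_right (fun x => (Env.par_ι x).symm) n _).symm
  -- only the parity of the degree of `p.1` matters
  obtain ⟨i, hi, hi'⟩ : ∃ i : Fin 2, IsHomog K i (F.coeff p.1) ∧
      ∀ z : Env K 𝔤, (par K)^[oddDeg d p.1] z = (par K)^[(i : ℕ)] z := by
    have h1 := iterate_par_coeff hF 1 p.1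
    rw [one_mul, Function.iterate_one] at h1
    have hinv : ∀ k, ∀ z : Env K 𝔤, (par K)^[k + k] z = z := by
      intro k z
      have h2 : Function.Involutive (par K : Env K 𝔤 → Env K 𝔤) := par_par
      rw [h2.iterate_even ⟨k, rfl⟩]
      rfl
    rcases Nat.even_or_odd' (oddDeg d p.1) with ⟨k, hk | hk⟩
    · refine ⟨0, ?_, fun z => ?_⟩
      · rw [IsHomog, h1, hk]
        simp
      · rw [hk, two_mul, hinv]
        rfl
    · refine ⟨1, ?_, fun z => ?_⟩
      · rw [IsHomog, h1, hk]
        simp [pow_add]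
      · rw [hk, two_mul, Function.iterate_succ_apply, hinv]
        rfl
  rw [iterate_par_coeff hF, coeff_map, coeff_map, hpar, hi',
    neg_one_pow_inversions c.2 (mem_antidiagonal.1 hp)]
  simp only [map_smul, LinearMap.smul_apply]
  rw [Env.ι_bracket hi]
  simp only [smul_mul_assoc, smul_smul, smul_sub]

/-! ### Series divisible by `ε` -/

variable (K d B) in
/-- The ideal of the series all of whose monomials contain `ε₀` (for `k = 0`), respectively `ε₁`
(for `k = 1`). Its square is zero. -/
def epsIdeal (k : Fin 2) : Submodule K (Series K d B) where
  carrier := {F | ∀ m : Mon d, m.1 (Var.eps k) = 0 → F m = 0}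
  add_mem' {F G} hF hG m hm := by
    change F m + G m = 0
    rw [hF m hm, hG m hm, add_zero]
  zero_mem' _ _ := rfl
  smul_mem' c F hF m hm := by
    change c • F m = 0
    rw [hF m hm, smul_zero]

theorem coeff_eq_zero_of_mem_epsIdeal {k : Fin 2} {F : Series K d B} (hF : F ∈ epsIdeal K d B k)
    {m : Var I →₀ ℕ} (hm : m (Var.eps k) = 0) : F.coeff m = 0 := by
  unfold coeff
  split_ifs with h
  · exact hF ⟨m, h⟩ hm
  · rfl

theorem mul_mem_epsIdeal_left {k : Fin 2} (F : Series K d B) {G : Series K d B}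
    (hG : G ∈ epsIdeal K d B k) : F * G ∈ epsIdeal K d B k := by
  intro c hc
  rw [mul_apply]
  refine Finset.sum_eq_zero fun p hp => ?_
  rw [← mem_antidiagonal.1 hp, Finsupp.add_apply] at hc
  rw [coeff_eq_zero_of_mem_epsIdeal hG (by omega), mul_zero, smul_zero]

theorem mul_mem_epsIdeal_right {k : Fin 2} {F : Series K d B} (hF : F ∈ epsIdeal K d B k)
    (G : Series K d B) : F * G ∈ epsIdeal K d B k := by
  intro c hc
  rw [mul_apply]
  refine Finset.sum_eq_zero fun p hp => ?_
  rw [← mem_antidiagonal.1 hp, Finsupp.add_apply] at hc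
  rw [coeff_eq_zero_of_mem_epsIdeal hF (by omega), iterate_par_zero, zero_mul, smul_zero]

theorem mul_eq_zero_of_mem_epsIdeal {k : Fin 2} {F G : Series K d B}
    (hF : F ∈ epsIdeal K d B k) (hG : G ∈ epsIdeal K d B k) : F * G = 0 := by
  funext c
  rw [mul_apply]
  refine Finset.sum_eq_zero fun p hp => ?_
  -- `ε₀` and `ε₁` occur at most once in the monomial `c`
  have hc : c.1 (Var.eps k) ≤ 1 := c.2 _ <| by
    rcases (by omega : k = 0 ∨ k = 1) with rfl | rfl
    · exact Or.inl rfl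
    · exact Or.inr rfl
  rw [← mem_antidiagonal.1 hp, Finsupp.add_apply] at hc
  rcases (by omega : p.1 (Var.eps k) = 0 ∨ p.2 (Var.eps k) = 0) with h | h
  · rw [coeff_eq_zero_of_mem_epsIdeal hF h, iterate_par_zero, zero_mul, smul_zero]
  · rw [coeff_eq_zero_of_mem_epsIdeal hG h, mul_zero, smul_zero]

theorem mem_degGE_one_of_mem_epsIdeal {k : Fin 2} {F : Series K d B}
    (hF : F ∈ epsIdeal K d B k) : F ∈ degGE K d B 1 := by
  intro m hm
  refine hF m ?_
  rw [(Finsupp.degree_eq_zero_iff _).1 (Nat.lt_one_iff.1 hm), Finsupp.zero_apply]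

theorem map_lsmul_eps_mem_epsIdeal (f : W →ₗ[K] B) (k : Fin 2) (F : Series K d W) :
    map f (lsmul (eps k) F) ∈ epsIdeal K d B k := by
  rw [map_lsmul_eq_mul]
  refine mul_mem_epsIdeal_right (fun m hm => ?_) _
  change Algebra.linearMap K B ((eps k : Series K d K) m) = 0
  unfold eps monomial
  rw [if_neg, map_zero]
  intro h
  rw [h, Finsupp.single_eq_same] at hm
  exact one_ne_zero hm

end RingStructure

end Series

/-! ### Exponential identities in an associative algebra -/

section Algebraic

variable {K : Type*} [Field K] [CharZero K]

variable (K) in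
/-- The power series `e^t`. -/
noncomputable def expSeries : PowerSeries K := PowerSeries.mk fun n => (n.factorial : K)⁻¹

theorem coeff_expSeries (n : ℕ) : PowerSeries.coeff n (expSeries K) = (n.factorial : K)⁻¹ :=
  PowerSeries.coeff_mk _ _

theorem coeff_expNeg (n : ℕ) :
    PowerSeries.coeff n (expNeg K) = (-1) ^ n * (n.factorial : K)⁻¹ :=
  PowerSeries.coeff_mk _ _

theorem factorial_inv_succ (n : ℕ) :
    ((n + 1 : ℕ) : K) * ((n + 1).factorial : K)⁻¹ = (n.factorial : K)⁻¹ := by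
  have h1 : ((n + 1 : ℕ) : K) ≠ 0 := Nat.cast_ne_zero.2 n.succ_ne_zero
  rw [Nat.factorial_succ, Nat.cast_mul, mul_inv, mul_inv_cancel_left₀ h1]

theorem succ_mul_coeff_expNegQuot (n : ℕ) :
    ((n + 1 : ℕ) : K) * PowerSeries.coeff n (-expNegQuot K) = PowerSeries.coeff n (expNeg K) := by
  rw [coeff_expNeg, map_neg, expNegQuot, PowerSeries.coeff_mk, ← factorial_inv_succ n]
  ring

/-- `e^S e^T = e^{S + T}` in each degree, for commuting `S` and `T`. -/
theorem sum_antidiagonal_exp {E : Type*} [Ring E] [Algebra K E] {S T : E} (h : Commute S T)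
    (n : ℕ) : ∑ p ∈ antidiagonal n,
      ((p.1.factorial : K)⁻¹ * (p.2.factorial : K)⁻¹) • (S ^ p.1 * T ^ p.2) =
        (n.factorial : K)⁻¹ • (S + T) ^ n := by
  rw [h.add_pow', Finset.smul_sum]
  refine Finset.sum_congr rfl fun p hp => ?_
  have hp' := mem_antidiagonal.1 hp
  rw [← Nat.cast_smul_eq_nsmul K, smul_smul]
  congr 1
  have h0 : ∀ k : ℕ, (k.factorial : K) ≠ 0 := fun k => Nat.cast_ne_zero.2 k.factorial_ne_zero
  have hn : (n.choose p.1 : K) * p.1.factorial * p.2.factorial = n.factorial := by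
    rw [← Nat.choose_mul_factorial_mul_factorial (show p.1 ≤ n by omega),
      show n - p.1 = p.2 by omega]
    push_cast
    rfl
  rw [← hn]
  have hc : (n.choose p.1 : K) ≠ 0 :=
    Nat.cast_ne_zero.2 (Nat.choose_pos (show p.1 ≤ n by omega)).ne'
  have h1 := h0 p.1
  have h2 := h0 p.2
  field_simp

variable {A : Type*} [Ring A] [Module K A] [SMulCommClass K A A] [IsScalarTower K A A]

variable (K) in
/-- The commutator `y ↦ x y - y x` with `x`. -/
def commutator (x : A) : Module.End K A := LinearMap.mulLeft K x - LinearMap.mulRight K x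

theorem commutator_apply (x y : A) : commutator K x y = x * y - y * x := rfl

theorem commute_mulLeft_commutator (x : A) :
    Commute (LinearMap.mulLeft K x) (commutator K x) :=
  (Commute.refl _).sub_right (LinearMap.commute_mulLeft_right x x)

/-- `e^x e^{-ad x} = e^{R_x}` in each degree, where `R_x` is the right multiplication by `x`. -/
theorem sum_antidiagonal_exp_commutator (x a : A) (n : ℕ) : ∑ p ∈ antidiagonal n,
    (PowerSeries.coeff p.1 (expSeries K) * PowerSeries.coeff p.2 (expNeg K)) •
      (LinearMap.mulLeft K x ^ p.1) ((commutator K x ^ p.2) a) =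
        PowerSeries.coeff n (expSeries K) • (LinearMap.mulRight K x ^ n) a := by
  have h := sum_antidiagonal_exp (K := K) (commute_mulLeft_commutator (K := K) x).neg_right n
  have h' := LinearMap.congr_fun h a
  rw [LinearMap.sum_apply, LinearMap.smul_apply] at h'
  have hR : LinearMap.mulLeft K x + -commutator K x = LinearMap.mulRight K x := by
    rw [commutator]
    abel
  rw [coeff_expSeries, ← hR, ← h']
  refine Finset.sum_congr rfl fun p _ => ?_
  have hneg : (-commutator K x) ^ p.2 = ((-1 : K) ^ p.2) • commutator K x ^ p.2 := by
    rw [← neg_one_smul K (commutator K x), smul_pow]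
  rw [coeff_expSeries, coeff_expNeg, hneg, mul_smul_comm, smul_smul, LinearMap.smul_apply,
    Module.End.mul_apply]
  congr 1
  ring

/-- The homogeneous part of degree `n + 1` of `e^x ((1 - e^{-ad x}) / ad x) a`, which is the
derivative of the exponential at `x` in the direction `a`. -/
noncomputable def dexpTerm (x a : A) (n : ℕ) : A := ∑ p ∈ antidiagonal n,
  (PowerSeries.coeff p.1 (expSeries K) * PowerSeries.coeff p.2 (-expNegQuot K)) •
    (LinearMap.mulLeft K x ^ p.1) ((commutator K x ^ p.2) a)

/-- The recursion is the homogeneous part of the differential equation for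
`t ↦ d/ds e^{t (x + s a)}` at `s = 0`. -/
theorem dexpTerm_succ (x a : A) (n : ℕ) : ((n + 2 : ℕ) : K) • dexpTerm (K := K) x a (n + 1) =
    x * dexpTerm (K := K) x a n + ((n + 1).factorial : K)⁻¹ • (a * x ^ (n + 1)) := by
  have hR : ∀ k, (LinearMap.mulRight K x ^ k) a = a * x ^ k := fun k => by
    rw [LinearMap.pow_mulRight, LinearMap.mulRight_apply]
  -- split the weight `n + 2` of the pair `p` as `p.1 + (p.2 + 1)`
  have hsplit : ((n + 2 : ℕ) : K) • dexpTerm (K := K) x a (n + 1) =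
      ∑ p ∈ antidiagonal (n + 1), ((p.1 : K) * PowerSeries.coeff p.1 (expSeries K) *
        PowerSeries.coeff p.2 (-expNegQuot K)) •
          (LinearMap.mulLeft K x ^ p.1) ((commutator K x ^ p.2) a) +
      ∑ p ∈ antidiagonal (n + 1), (PowerSeries.coeff p.1 (expSeries K) *
        PowerSeries.coeff p.2 (expNeg K)) •
          (LinearMap.mulLeft K x ^ p.1) ((commutator K x ^ p.2) a) := by
    rw [dexpTerm, Finset.smul_sum, ← Finset.sum_add_distrib]
    refine Finset.sum_congr rfl fun p hp => ?_
    have hp' : n + 2 = p.1 + (p.2 + 1) := by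
      have := mem_antidiagonal.1 hp
      omega
    rw [smul_smul, ← add_smul, ← succ_mul_coeff_expNegQuot, hp']
    congr 1
    push_cast
    ring
  rw [hsplit, sum_antidiagonal_exp_commutator, hR, coeff_expSeries,
    Finset.Nat.sum_antidiagonal_succ]
  congr 1
  rw [Nat.cast_zero, zero_mul, zero_mul, zero_smul, zero_add, dexpTerm, Finset.mul_sum]
  refine Finset.sum_congr rfl fun p _ => ?_
  dsimp only
  rw [coeff_expSeries, coeff_expSeries, factorial_inv_succ, pow_succ', Module.End.mul_apply,
    LinearMap.mulLeft_apply, mul_smul_comm]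

/-- First-order expansion of a power. The hypothesis holds for an increment `a` in an ideal of
square zero. -/
theorem add_pow_succ_eq {x a : A}
    (h : ∀ k l, a * (LinearMap.mulLeft K x ^ k) ((commutator K x ^ l) a) = 0) (n : ℕ) :
    (x + a) ^ (n + 1) = x ^ (n + 1) + ((n + 1).factorial : K) • dexpTerm (K := K) x a n := by
  have ha : ∀ n, a * dexpTerm (K := K) x a n = 0 := fun n => by
    rw [dexpTerm, Finset.mul_sum]
    exact Finset.sum_eq_zero fun p _ => by rw [mul_smul_comm, h, smul_zero]
  induction n with
  | zero => simp [dexpTerm, coeff_expSeries, expNegQuot]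
  | succ n ih =>
    have hf : ((n + 1).factorial : K) ≠ 0 := Nat.cast_ne_zero.2 (Nat.factorial_ne_zero _)
    have hs : ((n + 2).factorial : K) = ((n + 1).factorial : K) * ((n + 2 : ℕ) : K) := by
      rw [Nat.factorial_succ, Nat.cast_mul, mul_comm]
    rw [pow_succ', ih, hs, mul_smul, dexpTerm_succ, smul_add, smul_smul, mul_inv_cancel₀ hf,
      one_smul, add_mul, mul_add, mul_add, mul_smul_comm, mul_smul_comm, ha, smul_zero, add_zero,
      ← pow_succ']
    abel

end Algebraic

namespace Series

/-! ### Exponentials of series -/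

section Exponential

variable {K I : Type*} [Field K] [CharZero K] [LinearOrder I] {d : I → Fin 2} {B : Type*}
  [Ring B] [Algebra K B] [Superalgebra K B]

theorem raises_mulLeft {x : Series K d B} (hx : x ∈ degGE K d B 1) :
    Raises (LinearMap.mulLeft K x) :=
  raises_convₗ (LinearMap.mul K B) hx

theorem raises_mulRight {x : Series K d B} (hx : x ∈ degGE K d B 1) :
    Raises (LinearMap.mulRight K x) :=
  fun _ _ hF => conv_mem_degGE (LinearMap.mul K B) hF hx

theorem raises_commutator {x : Series K d B} (hx : x ∈ degGE K d B 1) :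
    Raises (commutator K x) := by
  rw [commutator, sub_eq_add_neg]
  exact (raises_mulLeft hx).add (raises_mulRight hx).neg

theorem filtered_mulLeft (x : Series K d B) : Filtered (LinearMap.mulLeft K x) :=
  filtered_convₗ (LinearMap.mul K B) x

theorem filtered_mulRight (x : Series K d B) : Filtered (LinearMap.mulRight K x) :=
  fun _ _ hF => conv_mem_degGE (LinearMap.mul K B) hF (mem_degGE_zero x)

theorem exp_eq_opSeries_mulLeft (x : Series K d B) :
    exp x = opSeries (expSeries K) (LinearMap.mulLeft K x) 1 := by
  rw [opSeries_eq_tsum]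
  simp only [LinearMap.pow_mulLeft, LinearMap.mulLeft_apply, mul_one, coeff_expSeries]
  rfl

theorem exp_eq_opSeries_mulRight (x : Series K d B) :
    exp x = opSeries (expSeries K) (LinearMap.mulRight K x) 1 := by
  rw [opSeries_eq_tsum]
  simp only [LinearMap.pow_mulRight, LinearMap.mulRight_apply, one_mul, coeff_expSeries]
  rfl

theorem exp_mul_eq_opSeries {x : Series K d B} (hx : x ∈ degGE K d B 1) (u : Series K d B) :
    exp x * u = opSeries (expSeries K) (LinearMap.mulLeft K x) u := by
  have h := map_opSeries (filtered_mulRight u) (raises_mulLeft hx) (raises_mulLeft hx)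
    (fun F => mul_assoc x F u) (expSeries K) 1
  rwa [← exp_eq_opSeries_mulLeft, LinearMap.mulRight_apply, LinearMap.mulRight_apply,
    one_mul] at h

theorem mul_exp_eq_opSeries {x : Series K d B} (hx : x ∈ degGE K d B 1) (u : Series K d B) :
    u * exp x = opSeries (expSeries K) (LinearMap.mulRight K x) u := by
  have h := map_opSeries (filtered_mulLeft u) (raises_mulRight hx) (raises_mulRight hx)
    (fun F => (mul_assoc u F x).symm) (expSeries K) 1
  rwa [← exp_eq_opSeries_mulRight, LinearMap.mulLeft_apply, LinearMap.mulLeft_apply,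
    mul_one] at h

/-- `e^{-x} u e^x = e^{-ad x} u`. -/
theorem mul_exp_eq_exp_mul {x : Series K d B} (hx : x ∈ degGE K d B 1) (u : Series K d B) :
    u * exp x = exp x * opSeries (expNeg K) (commutator K x) u := by
  rw [exp_mul_eq_opSeries hx, mul_exp_eq_opSeries hx,
    opSeries_opSeries _ _ (raises_mulLeft hx) (raises_commutator hx), opSeries_eq_tsum]
  simp only [sum_antidiagonal_exp_commutator]

theorem exp_eq_one_add {k : Fin 2} {u : Series K d B} (hu : u ∈ epsIdeal K d B k) :
    exp u = 1 + u := by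
  have h2 : ∀ n, u ^ (n + 2) = 0 := fun n => by
    rw [pow_add, pow_two, mul_eq_zero_of_mem_epsIdeal hu hu, mul_zero]
  funext m
  refine (finsum_eq_sum_of_support_subset (s := Finset.range 2) _ fun n hn => ?_).trans ?_
  · by_contra h
    rw [Finset.coe_range, Set.mem_Iio, not_lt] at h
    obtain ⟨j, rfl⟩ := Nat.exists_eq_add_of_le' h
    refine hn ?_
    change (((j + 2).factorial : K)⁻¹ • u ^ (j + 2)) m = 0
    rw [h2, smul_zero, zero_apply]
  · rw [← sum_apply (K := K), Finset.sum_range_succ, Finset.sum_range_one]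
    simp

/-- The derivative of the exponential: `e^{x + a} = e^x (1 + ((1 - e^{-ad x}) / ad x) a)` for
`a` divisible by `ε`. -/
theorem exp_add_eq {k : Fin 2} {x a : Series K d B} (hx : x ∈ degGE K d B 1)
    (ha : a ∈ epsIdeal K d B k) :
    exp (x + a) = exp x * (1 + opSeries (-expNegQuot K) (commutator K x) a) := by
  have hcomm : ∀ l, (commutator K x ^ l) a ∈ epsIdeal K d B k := by
    intro l
    induction l with
    | zero => exact ha
    | succ l ih =>
      rw [pow_succ', Module.End.mul_apply, commutator_apply]
      exact sub_mem (mul_mem_epsIdeal_left x ih) (mul_mem_epsIdeal_right ih x)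
  have hpow := add_pow_succ_eq (K := K) (x := x) (a := a) fun k l => by
    rw [LinearMap.pow_mulLeft, LinearMap.mulLeft_apply]
    exact mul_eq_zero_of_mem_epsIdeal ha (mul_mem_epsIdeal_left _ (hcomm l))
  have hterm : ∀ n, ((n + 1).factorial : K)⁻¹ • (x + a) ^ (n + 1) =
      ((n + 1).factorial : K)⁻¹ • x ^ (n + 1) + dexpTerm (K := K) x a n := fun n => by
    rw [hpow, smul_add, smul_smul,
      inv_mul_cancel₀ (Nat.cast_ne_zero.2 (Nat.factorial_ne_zero _)), one_smul]
  have htrunc : ∀ y ∈ degGE K d B 1, ∀ n, exp y - (∑ i ∈ Finset.range n,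
      ((i + 1).factorial : K)⁻¹ • y ^ (i + 1) + 1) ∈ degGE K d B n := by
    intro y hy n
    have h := opSeries_sub_sum_range_mem (expSeries K) (raises_mulLeft hy) 1 (n + 1)
    rw [← exp_eq_opSeries_mulLeft, Finset.sum_range_succ'] at h
    simp only [LinearMap.pow_mulLeft, LinearMap.mulLeft_apply, mul_one, coeff_expSeries,
      Nat.factorial_zero, Nat.cast_one, inv_one, one_smul, pow_zero] at h
    exact degGE_anti (Nat.le_succ n) h
  rw [mul_add, mul_one, exp_mul_eq_opSeries hx,
    opSeries_opSeries _ _ (raises_mulLeft hx) (raises_commutator hx)]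
  refine eq_of_forall_sub_mem_degGE fun n => ?_
  have h1 := htrunc _ (add_mem hx (mem_degGE_one_of_mem_epsIdeal ha)) n
  have h2 := htrunc _ hx n
  have h3 := tsum_sub_sum_range_mem (sum_antidiagonal_mem_degGE (expSeries K) (-expNegQuot K)
    (raises_mulLeft hx) (raises_commutator hx) a) n
  simp only [hterm, Finset.sum_add_distrib] at h1
  change tsum _ - ∑ i ∈ Finset.range n, dexpTerm (K := K) x a i ∈ _ at h3
  convert sub_mem h1 (add_mem h2 h3) using 1
  abel

end Exponential

/-! ### Compressions of operators to a direct summand -/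

section Compression

variable {K I : Type*} [Field K] [LinearOrder I] {d : I → Fin 2} {𝔤 : Type*}
  [AddCommGroup 𝔤] [Module K 𝔤] {V U : Submodule K 𝔤} (hVU : IsCompl V U)
  {D : Module.End K (Series K d 𝔤)}

theorem map_projectionOnto_map_subtype (F : Series K d V) :
    map (V.projectionOnto U hVU) (map V.subtype F) = F :=
  funext fun m => V.projectionOnto_apply_left hVU (F m)

theorem map_projectionOnto_map_subtype_right (F : Series K d U) :
    map (V.projectionOnto U hVU) (map U.subtype F) = 0 :=
  funext fun m => V.projectionOnto_apply_right hVU (F m)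

theorem map_subtype_map_projectionOnto {F : Series K d 𝔤}
    (hF : map (U.projectionOnto V hVU.symm) F = 0) :
    map V.subtype (map (V.projectionOnto U hVU) F) = F := funext fun m => by
  have h : F m ∈ V := (U.projectionOnto_apply_eq_zero_iff hVU.symm).1 (congrFun hF m)
  exact congrArg Subtype.val (V.projectionOnto_apply_of_mem_left hVU h)

theorem projectionOnto_restrict {p : 𝔤 →ₗ[K] 𝔤} (hV : ∀ x ∈ V, p x ∈ V) (hU : ∀ x ∈ U, p x ∈ U)
    (x : 𝔤) : V.projectionOnto U hVU (p x) = p.restrict hV (V.projectionOnto U hVU x) := by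
  obtain ⟨v, hv, u, hu, rfl⟩ :=
    Submodule.mem_sup.1 (hVU.sup_eq_top ▸ Submodule.mem_top : x ∈ V ⊔ U)
  simp only [map_add]
  rw [V.projectionOnto_apply_of_mem_left hVU hv, V.projectionOnto_apply_of_mem_left hVU (hV v hv),
    V.projectionOnto_apply_of_mem_right hVU hu,
    V.projectionOnto_apply_of_mem_right hVU (hU u hu), map_zero, add_zero, add_zero]
  rfl

/-- The compression of `f(D)` to `A ⊗̂ V`, for a decomposition `𝔤 = V ⊕ U`. -/
noncomputable def compression (hD : Raises D) (f : PowerSeries K) : Module.End K (Series K d V) :=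
  map (V.projectionOnto U hVU) ∘ₗ opSeriesₗ f hD ∘ₗ map V.subtype

theorem bijective_compression (hD : Raises D) {f : PowerSeries K}
    (hf : PowerSeries.constantCoeff f ≠ 0) :
    Function.Bijective (compression hVU hD f) := by
  refine bijective_of_sub_smul_mem hf fun n F hF => ?_
  have h := filtered_map (V.projectionOnto U hVU) _ _
    (opSeries_sub_smul_mem f hD (filtered_map V.subtype n F hF))
  rwa [map_sub, map_smul, map_projectionOnto_map_subtype] at h

/-- The inverse of an invertible compression commutes with the diagonal operators commuting with
`D` and preserving the decomposition. -/
theorem symm_twist (hD : Raises D) {f : PowerSeries K} {T : Series K d V ≃ₗ[K] Series K d V}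
    (hT : ∀ F, T F = map (V.projectionOnto U hVU) (opSeries f D (map V.subtype F)))
    {s : Mon d → K} {p : 𝔤 →ₗ[K] 𝔤} (hV : ∀ x ∈ V, p x ∈ V) (hU : ∀ x ∈ U, p x ∈ U)
    (hDp : ∀ F, twist s p (D F) = D (twist s p F)) (F : Series K d V) :
    T.symm (twist s (p.restrict hV) F) = twist s (p.restrict hV) (T.symm F) := by
  rw [LinearEquiv.symm_apply_eq, hT, map_twist s (f := V.subtype) (p' := p) (fun _ => rfl),
    ← map_opSeries (filtered_twist s p) hD hD hDp,
    map_twist s (projectionOnto_restrict hVU hV hU), ← hT, LinearEquiv.apply_symm_apply]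

theorem opSeries_neg (f : PowerSeries K) (F : Series K d 𝔤) :
    opSeries (-f) D F = -opSeries f D F := by
  funext m
  rw [neg_apply]
  refine Eq.trans (finsum_congr fun n => ?_) (finsum_neg_distrib _)
  change (PowerSeries.coeff n (-f) • (D^[n] F) m) = -(PowerSeries.coeff n f • (D^[n] F) m)
  rw [map_neg, neg_smul]

/-- The splitting of an element `y` of `A ⊗̂ 𝔤` along `f(D) (A ⊗̂ V) ⊕ (A ⊗̂ U)`: the components
are obtained by projecting `y` to `V` and `f(D)⁻¹ y` to `U`. -/
theorem eq_opSeries_add_of_symm (hD : Raises D) {f f' : PowerSeries K} (hff' : f * f' = 1)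
    {T : Series K d V ≃ₗ[K] Series K d V} {T' : Series K d U ≃ₗ[K] Series K d U}
    (hT : ∀ F, T F = map (V.projectionOnto U hVU) (opSeries f D (map V.subtype F)))
    (hT' : ∀ F, T' F = map (U.projectionOnto V hVU.symm) (opSeries f' D (map U.subtype F)))
    (y : Series K d 𝔤) :
    y = opSeries (-f) D (map V.subtype (-T.symm (map (V.projectionOnto U hVU) y))) +
      map U.subtype (T'.symm (map (U.projectionOnto V hVU.symm) (opSeries f' D y))) := by
  set A := -T.symm (map (V.projectionOnto U hVU) y) with hA
  set z := y + opSeries f D (map V.subtype A) with hz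
  have hzV : map (V.projectionOnto U hVU) z = 0 := by
    rw [hz, map_add, ← hT, hA, map_neg, LinearEquiv.apply_symm_apply, add_neg_cancel]
  have hzU : map U.subtype (map (U.projectionOnto V hVU.symm) z) = z :=
    map_subtype_map_projectionOnto hVU.symm hzV
  have hz' : opSeries f' D z = opSeries f' D y + map V.subtype A := by
    rw [hz, ← opSeriesₗ_apply f' hD, map_add, opSeriesₗ_apply, opSeriesₗ_apply,
      ← opSeries_mul f' f hD, mul_comm f' f, hff', opSeries_one]
  have hB : T'.symm (map (U.projectionOnto V hVU.symm) (opSeries f' D y)) =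
      map (U.projectionOnto V hVU.symm) z := by
    rw [LinearEquiv.symm_apply_eq, hT', hzU, hz', map_add,
      map_projectionOnto_map_subtype_right hVU.symm, add_zero]
  rw [hB, hzU, opSeries_neg, hz]
  abel

end Compression

theorem constantCoeff_expNegQuot {K : Type*} [Field K] :
    PowerSeries.constantCoeff (expNegQuot K) = -1 := by
  rw [← PowerSeries.coeff_zero_eq_constantCoeff_apply, expNegQuot, PowerSeries.coeff_mk]
  simp

theorem constantCoeff_tDivExpNeg_ne_zero {K : Type*} [Field K] :
    PowerSeries.constantCoeff (tDivExpNeg K) ≠ 0 := by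
  rw [tDivExpNeg, PowerSeries.constantCoeff_inv, constantCoeff_expNegQuot]
  simp

section Const

variable {K I : Type*} [Field K] [LinearOrder I] {d : I → Fin 2} {𝔤 : Type*}
  [AddCommGroup 𝔤] [Module K 𝔤]

variable (K d 𝔤) in
/-- The embedding `w ↦ 1 ⊗ w`. -/
noncomputable def constₗ : 𝔤 →ₗ[K] Series K d 𝔤 where
  toFun := const
  map_add' v w := funext fun m => by
    rw [add_apply]
    unfold const monomial
    split_ifs
    · rfl
    · rw [add_zero]
  map_smul' c w := funext fun m => by
    rw [RingHom.id_apply, smul_apply]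
    unfold const monomial
    split_ifs
    · rfl
    · rw [smul_zero]

end Const

/-! ### Factorization of `e^{εg} e^{x}` -/

section Factorization

variable {K I : Type*} [Field K] [CharZero K] [LinearOrder I] {d : I → Fin 2} {𝔤 : Type*}
  [AddCommGroup 𝔤] [Module K 𝔤] [LieSuperalgebra K 𝔤]

theorem parity_map_ι {F : Series K d 𝔤} (hF : F.parity = F) :
    (map (Env.ι K 𝔤) F).parity = map (Env.ι K 𝔤) F := by
  conv_rhs => rw [← hF]
  exact (map_twist _ (fun w => (Env.par_ι w).symm) F).symm

theorem map_ι_mem_degGE {F : Series K d 𝔤} {n : ℕ} (hF : F ∈ degGE K d 𝔤 n) :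
    map (Env.ι K 𝔤) F ∈ degGE K d (Env K 𝔤) n :=
  filtered_map _ n F hF

/-- The map `G ↦ ε G` to `A ⊗̂ U(𝔤)` turns power series in `ad F` into power series in the
commutator with `F`. -/
theorem map_ι_lsmul_opSeries {F : Series K d 𝔤} (hF : F.parity = F)
    (hF1 : F ∈ degGE K d 𝔤 1) (a : Series K d K) (f : PowerSeries K) (G : Series K d 𝔤) :
    map (Env.ι K 𝔤) (lsmul a (opSeries f (ad F) G)) =
      opSeries f (commutator K (map (Env.ι K 𝔤) F)) (map (Env.ι K 𝔤) (lsmul a G)) := by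
  have hcomm := (commute_map_algebra (parity_map_ι hF) a).eq
  refine map_opSeries (Φ := map (Env.ι K 𝔤) ∘ₗ convₗ (LinearMap.lsmul K 𝔤) a)
    (T := convₗ LieSuperalgebra.bracket F)
    (fun n G hG => map_ι_mem_degGE (filtered_convₗ _ a n G hG)) (raises_convₗ _ hF1)
    (raises_commutator (map_ι_mem_degGE hF1)) (fun G => ?_) f G
  change map (Env.ι K 𝔤) (lsmul a (ad F G)) = commutator K _ (map (Env.ι K 𝔤) (lsmul a G))
  rw [map_lsmul_eq_mul, map_lsmul_eq_mul, map_ι_ad hF, commutator_apply, mul_sub, ← mul_assoc,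
    ← mul_assoc, ← mul_assoc, hcomm]

/-- To first order in `ε`, the factorization of `e^{εg} e^F` amounts to the splitting
`e^{-ad F} g = ((1 - e^{-ad F}) / ad F) A + B`. -/
theorem exp_lsmul_eps_mul_exp {F : Series K d 𝔤} (hF : F.parity = F)
    (hF1 : F ∈ degGE K d 𝔤 1) (k : Fin 2) {g A B : Series K d 𝔤}
    (h : opSeries (expNeg K) (ad F) g = opSeries (-expNegQuot K) (ad F) A + B) :
    (map (Env.ι K 𝔤) (lsmul (eps k) g)).exp * (map (Env.ι K 𝔤) F).exp =
      (map (Env.ι K 𝔤) (F + lsmul (eps k) A)).exp *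
        (map (Env.ι K 𝔤) (lsmul (eps k) B)).exp := by
  have hx := map_ι_mem_degGE hF1
  have hmem := map_lsmul_eps_mem_epsIdeal (d := d) (Env.ι K 𝔤) k
  have hadd : ∀ G H : Series K d 𝔤, lsmul (eps k) (G + H) = lsmul (eps k) G + lsmul (eps k) H :=
    (convₗ (LinearMap.lsmul K 𝔤) (eps k)).map_add
  have hzero := mul_eq_zero_of_mem_epsIdeal (hmem (opSeries (-expNegQuot K) (ad F) A)) (hmem B)
  rw [map_add, exp_eq_one_add (hmem g), exp_eq_one_add (hmem B), exp_add_eq hx (hmem A), add_mul,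
    one_mul, mul_exp_eq_exp_mul hx, ← map_ι_lsmul_opSeries hF hF1, h, hadd, map_add,
    ← map_ι_lsmul_opSeries hF hF1, mul_assoc]
  simp only [mul_add, add_mul, mul_one, one_mul, hzero, add_zero]
  abel

end Factorization

end Series

end SuperSeries

theorem mainTheorem2 {K : Type*} [Field K] [CharZero K]
    {𝔤 : Type*} [AddCommGroup 𝔤] [Module K 𝔤] [LieSuperalgebra K 𝔤]
    -- a decomposition into a direct sum of sub-superspaces
    (𝔤m 𝔥 : Submodule K 𝔤) (hc : IsCompl 𝔤m 𝔥)
    (hm : ∀ x ∈ 𝔤m, par K x ∈ 𝔤m) (hh : ∀ x ∈ 𝔥, par K x ∈ 𝔥)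
    -- a homogeneous basis of the first summand
    {I : Type*} [LinearOrder I] (d : I → Fin 2) (P : Module.Basis I K 𝔤m)
    (hP : ∀ i, IsHomog K (d i) (P i : 𝔤)) :
    let XP : Series K d 𝔤 := Series.pairing (fun i => Series.X i) (fun i => (P i : 𝔤))
    let incl_m : Series K d 𝔤m →ₗ[K] Series K d 𝔤 := Series.map 𝔤m.subtype
    let incl_h : Series K d 𝔥 →ₗ[K] Series K d 𝔤 := Series.map 𝔥.subtype
    let proj_m : Series K d 𝔤 →ₗ[K] Series K d 𝔤m := Series.map (𝔤m.projectionOnto 𝔥 hc)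
    let proj_h : Series K d 𝔤 →ₗ[K] Series K d 𝔥 := Series.map (𝔥.projectionOnto 𝔤m hc.symm)
    let toU : Series K d 𝔤 →ₗ[K] Series K d (Env K 𝔤) := Series.map (Env.ι K 𝔤)
    -- the restricted operators are invertible, and there are even linear maps `𝒜`, `ℬ`
    ∃ (Tm : Series K d 𝔤m ≃ₗ[K] Series K d 𝔤m) (Th : Series K d 𝔥 ≃ₗ[K] Series K d 𝔥)
      (𝒜 : 𝔤 →ₗ[K] Series K d 𝔤m) (ℬ : 𝔤 →ₗ[K] Series K d 𝔥),
      (∀ F, Tm F = proj_m (Series.opSeries (expNegQuot K) (Series.ad XP) (incl_m F))) ∧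
      (∀ F, Th F = proj_h (Series.opSeries (tDivExpNeg K) (Series.ad XP) (incl_h F))) ∧
      (∀ g, (𝒜 g).EpsFree ∧ (ℬ g).EpsFree) ∧
      (∀ g, incl_m (𝒜 (par K g)) = (incl_m (𝒜 g)).parity ∧
        incl_h (ℬ (par K g)) = (incl_h (ℬ g)).parity) ∧
      -- the explicit formulas
      (∀ g, 𝒜 g =
        -Tm.symm (proj_m (Series.opSeries (expNeg K) (Series.ad XP) (Series.const g)))) ∧
      (∀ g, ℬ g =
        Th.symm (proj_h (Series.opSeries (tDivExpNeg K) (Series.ad XP)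
          (Series.opSeries (expNeg K) (Series.ad XP) (Series.const g))))) ∧
      -- the identity, where `φ i` is the `i`-th coordinate series of `𝒜 g` in the basis `P`
      ∀ (k : Fin 2) (g : 𝔤), IsHomog K k g →
        let ε : Series K d K := Series.eps k
        let φ : I → Series K d K := fun i => Series.map (P.coord i) (𝒜 g)
        let shifted : Series K d 𝔤 :=
          Series.pairing (fun i => Series.X i + ε * φ i) (fun i => (P i : 𝔤))
        incl_m (𝒜 g) = Series.pairing φ (fun i => (P i : 𝔤)) ∧
        shifted = XP + Series.lsmul ε (incl_m (𝒜 g)) ∧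
        (toU (Series.lsmul ε (Series.const g))).exp * (toU XP).exp =
          (toU shifted).exp * (toU (Series.lsmul ε (incl_h (ℬ g)))).exp := by
  intro XP incl_m incl_h proj_m proj_h toU
  have hpar : XP.parity = XP := Series.parity_pairing_X hP
  have hone : XP ∈ Series.degGE K d 𝔤 1 := Series.pairing_X_mem_degGE _
  have hfree : XP.EpsFree := Series.epsFree_pairing_X _
  let D : Module.End K (Series K d 𝔤) := Series.convₗ LieSuperalgebra.bracket XP
  have hD : Series.Raises D := Series.raises_convₗ _ hone
  let Tm : Series K d 𝔤m ≃ₗ[K] Series K d 𝔤m := LinearEquiv.ofBijective _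
    (Series.bijective_compression hc hD (f := expNegQuot K) (by
      rw [Series.constantCoeff_expNegQuot]
      exact neg_ne_zero.2 one_ne_zero))
  let Th : Series K d 𝔥 ≃ₗ[K] Series K d 𝔥 := LinearEquiv.ofBijective _
    (Series.bijective_compression hc.symm hD (f := tDivExpNeg K)
      Series.constantCoeff_tDivExpNeg_ne_zero)
  have hTm : ∀ F, Tm F = proj_m (Series.opSeries (expNegQuot K) D (incl_m F)) := fun _ => rfl
  have hTh : ∀ F, Th F = proj_h (Series.opSeries (tDivExpNeg K) D (incl_h F)) := fun _ => rfl
  let 𝒜 : 𝔤 →ₗ[K] Series K d 𝔤m :=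
    -(Tm.symm.toLinearMap ∘ₗ proj_m ∘ₗ Series.opSeriesₗ (expNeg K) hD ∘ₗ Series.constₗ K d 𝔤)
  let ℬ : 𝔤 →ₗ[K] Series K d 𝔥 :=
    Th.symm.toLinearMap ∘ₗ proj_h ∘ₗ Series.opSeriesₗ (tDivExpNeg K) hD ∘ₗ
      Series.opSeriesₗ (expNeg K) hD ∘ₗ Series.constₗ K d 𝔤
  have h𝒜 : ∀ g, 𝒜 g = -Tm.symm (proj_m (Series.opSeries (expNeg K) D (Series.const g))) :=
    fun _ => rfl
  have hℬ : ∀ g, ℬ g = Th.symm (proj_h (Series.opSeries (tDivExpNeg K) D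
      (Series.opSeries (expNeg K) D (Series.const g)))) := fun _ => rfl
  -- `𝒜` and `ℬ` commute with every diagonal operator that commutes with `ad XP`
  have htwist : ∀ (s : Mon d → K) (p : 𝔤 →ₗ[K] 𝔤) (hpm : ∀ x ∈ 𝔤m, p x ∈ 𝔤m)
      (hph : ∀ x ∈ 𝔥, p x ∈ 𝔥), s ⟨0, Series.adm_zero⟩ = 1 →
      (∀ F, Series.twist s p (D F) = D (Series.twist s p F)) → ∀ g,
      𝒜 (p g) = Series.twist s (p.restrict hpm) (𝒜 g) ∧
        ℬ (p g) = Series.twist s (p.restrict hph) (ℬ g) := by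
    intro s p hpm hph hs hp g
    have hop : ∀ f F, Series.opSeries f D (Series.twist s p F) =
        Series.twist s p (Series.opSeries f D F) := fun f F =>
      (Series.map_opSeries (Series.filtered_twist s p) hD hD hp f F).symm
    rw [h𝒜, h𝒜, hℬ, hℬ, ← Series.twist_const s hs, hop, hop,
      Series.map_twist s (Series.projectionOnto_restrict hc hpm hph),
      Series.map_twist s (Series.projectionOnto_restrict hc.symm hph hpm),
      Series.symm_twist hc hD hTm hpm hph hp, Series.symm_twist hc.symm hD hTh hph hpm hp,
      map_neg]
    exact ⟨rfl, rfl⟩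
  refine ⟨Tm, Th, 𝒜, ℬ, hTm, hTh, fun g => ?_, fun g => ?_, h𝒜, hℬ, fun k g _ => ?_⟩
  · have h := htwist Series.epsFreeInd LinearMap.id (fun _ hx => hx) (fun _ hx => hx)
      (if_neg (by simp)) (fun F => (Series.ad_epsFree hpar hfree F).symm) g
    exact ⟨(Series.epsFree_iff_twist _).2 h.1.symm, (Series.epsFree_iff_twist _).2 h.2.symm⟩
  · have h := htwist (fun m => (-1) ^ oddDeg d m.1) (par K) hm hh
      (by simp [Series.oddDeg_zero]) (fun F => (Series.ad_parity hpar F).symm) g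
    rw [h.1, h.2]
    exact ⟨rfl, rfl⟩
  · intro ε φ shifted
    have hshift : shifted = XP + Series.lsmul ε (incl_m (𝒜 g)) :=
      Series.pairing_X_add_eps_mul P ε (𝒜 g)
    refine ⟨(Series.pairing_coord P (𝒜 g)).symm, hshift, ?_⟩
    rw [hshift]
    exact Series.exp_lsmul_eps_mul_exp hpar hone k
      (Series.eq_opSeries_add_of_symm hc hD (expNegQuot_mul_tDivExpNeg K) hTm hTh _)
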